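/- A \emph{stratified set} $A$ is a simplicial set together with a set $tA$ of \emph{thin} simplices which contains all degenerate simplices and no $0$-simplex; a \emph{stratified map} is a simplicial map that preserves thinness. A \emph{regular subset} of $X$ is a simplicial subset whose thin simplices are exactly those that are thin in $X$. We say that $A$ has the RLP with respect to a stratified map $i\colon U\to V$ if every stratified map $U\to A$ extends along $i$ to a stratified map $V\to A$. For $n\ge 1$ and $0\le k\le n$ let $\Delta^k[n]$ be the standard simplex $\Delta[n]$ whose thin simplices are the degenerate ones and those $\alpha\colon[r]\to[n]$ whose image contains $\{k-1,k,k+1\}\cap[n]$. Let $\Lambda^k[n]\subseteq\Delta^k[n]$ be the regular subset carried by the usual $k$-horn. For $n\ge2$ let $\Delta^k[n]'$ (resp. $\Delta^k[n]''$) be obtained from $\Delta^k[n]$ by also making thin all $(n-1)$-simplices that lie in $\Lambda^k[n]$ (resp. all $(n-1)$-simplices). The \emph{elementary anodyne extensions} are the inclusions $\Lambda^k[n]\subseteq\Delta^k[n]$ ($n\ge1$, $0\le k\le n$) and $\Delta^k[n]'\subseteq\Delta^k[n]''$ ($n\ge2$, $0\le k\le n$); they are \emph{inner} if $0<k<n$.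 A stratified set is a \emph{weak complicial set} (resp. \emph{weak inner complicial set}) if it has the RLP with respect to all (resp. all inner) elementary anodyne extensions. Let $E$ be the nerve of the chaotic category (exactly one morphism between any two objects) on $\{-,+\}$. Let $E^-_1\subseteq E$ be the simplicial subset generated by the $1$-simplex $-+$, and $E_2\subseteq E$ the one generated by the $2$-simplices $-+-$ and $+-+$, both stratified so that a simplex is thin if and only if its dimension is positive. Then $E^-_1$ is a regular subset of $E_2$. \textbf{Corollary.} Let $A$ be a weak inner complicial set. Then $A$ is a weak complicial set if and only if it has the RLP with respect to the inclusion $E^-_1\subseteq E_2$. Moreover, $A$ has this RLP if and only if each thin $1$-simplex of $A$ has an equivalence inverse, that is, for every thin $1$-simplex $v\colon x\to y$ of $A$ there are a thin $1$-simplex $w\colon y\to x$ and thin $2$-simplices $a,a'$ of $A$ such that $$d_2a=v,\quad d_0a=w,\quad d_1a=s_0x,\qquad d_2a'=w,\quad d_0a'=v,\quad d_1a'=s_0y .$$ -/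

import Mathlib

open CategoryTheory Simplicial

universe u

/-- A stratified (simplicial) set: a simplicial set with a chosen set of thin simplices which
contains every degenerate simplex and contains no `0`-simplex. -/
structure StratSet : Type (u + 1) where
  /-- the underlying simplicial set -/
  toSSet : SSet.{u}
  /-- the thin simplices of each dimension -/
  thin : ∀ n : ℕ, Set (toSSet _⦋n⦌)
  notMem_thin_zero : ∀ x : toSSet _⦋0⦌, x ∉ thin 0
  degenerate_subset_thin : ∀ n : ℕ, toSSet.degenerate n ⊆ thin n

namespace StratSet

/-- A stratified map: a simplicial map which preserves thinness. -/
@[ext]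
structure Hom (X Y : StratSet.{u}) : Type u where
  /-- the underlying simplicial map -/
  toSSetHom : X.toSSet ⟶ Y.toSSet
  map_thin : ∀ (n : ℕ) (x : X.toSSet _⦋n⦌), x ∈ X.thin n → toSSetHom.app _ x ∈ Y.thin n

/-- The category of stratified sets and stratified maps. -/
instance : Category.{u} StratSet.{u} where
  Hom X Y := Hom X Y
  id X := { toSSetHom := 𝟙 X.toSSet, map_thin := fun _ _ hx => hx }
  comp f g :=
    { toSSetHom := f.toSSetHom ≫ g.toSSetHom
      map_thin := fun n x hx => g.map_thin n _ (f.map_thin n x hx) }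

/-- A simplicial set with its minimal stratification: thin means degenerate. -/
def minimal (X : SSet.{u}) : StratSet.{u} where
  toSSet := X
  thin n := X.degenerate n
  notMem_thin_zero x := by simp
  degenerate_subset_thin _ := subset_rfl

/-- The stratified set obtained from `X` by also making thin the simplices in `T`.
As `0`-simplices are never thin, those that lie in `T` are ignored. -/
def addThin (X : StratSet.{u}) (T : ∀ r : ℕ, Set (X.toSSet _⦋r⦌)) : StratSet.{u} where
  toSSet := X.toSSet
  thin r := {x | x ∈ X.thin r ∨ (0 < r ∧ x ∈ T r)}
  notMem_thin_zero x := by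
    rintro (h | ⟨h, -⟩)
    · exact X.notMem_thin_zero x h
    · exact lt_irrefl _ h
  degenerate_subset_thin r _ hx := Or.inl (X.degenerate_subset_thin r hx)

/-- For `T ⊆ T'` the entire inclusion of `X.addThin T` in `X.addThin T'`
(the identity on simplices). -/
def addThinInclusion (X : StratSet.{u}) {T T' : ∀ r : ℕ, Set (X.toSSet _⦋r⦌)}
    (h : ∀ r, T r ⊆ T' r) : X.addThin T ⟶ X.addThin T' where
  toSSetHom := 𝟙 X.toSSet
  map_thin r _ hx := hx.imp_right fun hx' => ⟨hx'.1, h r hx'.2⟩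

/-- The regular subset of `X` carried by a simplicial subset `U` of `X`: a simplex of `U` is
thin if and only if it is thin in `X`. -/
def regularSubset (X : StratSet.{u}) (U : X.toSSet.Subcomplex) : StratSet.{u} where
  toSSet := U
  thin r := {x | U.ι.app _ x ∈ X.thin r}
  notMem_thin_zero _ := X.notMem_thin_zero _
  degenerate_subset_thin r x hx := by
    obtain ⟨m, hm, f, y, rfl⟩ := hx
    exact X.degenerate_subset_thin r ⟨m, hm, f, U.ι.app _ y, rfl⟩

/-- The inclusion of a regular subset. -/
def regularInclusion (X : StratSet.{u}) (U : X.toSSet.Subcomplex) : X.regularSubset U ⟶ X where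
  toSSetHom := U.ι
  map_thin _ _ hx := hx

/-- The inclusion of a regular subset in a larger one. -/
def regularInclusionOfLE (X : StratSet.{u}) {U V : X.toSSet.Subcomplex} (h : U ≤ V) :
    X.regularSubset U ⟶ X.regularSubset V where
  toSSetHom := SSet.Subcomplex.homOfLE h
  map_thin _ _ hx := hx

/-- The `n`-trivialisation of `X`: all simplices of dimension greater than `n` are made thin. -/
def triv (n : ℕ) (X : StratSet.{u}) : StratSet.{u} :=
  X.addThin fun r => {_x | n < r}

/-- The object `A` has the right lifting property with respect to `i : U ⟶ V`: every map
`U ⟶ A` extends along `i`. (This is the right lifting property of the map from `A` to the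
terminal stratified set.) -/
def HasRLP {U V : StratSet.{u}} (i : U ⟶ V) (A : StratSet.{u}) : Prop :=
  ∀ f : U ⟶ A, ∃ g : V ⟶ A, i ≫ g = f

/-- The `k`-complicial `n`-simplex `Δᵏ[n]`: the standard simplex `Δ[n]` in which those simplices
`α : [r] → [n]` are made thin whose image contains `{k - 1, k, k + 1} ∩ [n]`. -/
def complicialSimplex (n : ℕ) (k : Fin (n + 1)) : StratSet.{u} :=
  (minimal Δ[n]).addThin fun r =>
    {α : (Δ[n] : SSet.{u}) _⦋r⦌ | ∀ i : Fin (n + 1),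
      ((i : ℕ) + 1 = k ∨ (i : ℕ) = k ∨ (i : ℕ) = k + 1) →
        i ∈ Set.range (SSet.stdSimplex.asOrderHom α)}

/-- The complicial horn `Λᵏ[n]`, a regular subset of `Δᵏ[n]`. -/
def complicialHorn (n : ℕ) (k : Fin (n + 1)) : StratSet.{u} :=
  (complicialSimplex n k).regularSubset (SSet.horn n k)

/-- The complicial horn extension `Λᵏ[n] ⊆ Δᵏ[n]`. -/
def hornExtension (n : ℕ) (k : Fin (n + 1)) :
    complicialHorn.{u} n k ⟶ complicialSimplex.{u} n k :=
  (complicialSimplex n k).regularInclusion (SSet.horn n k)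

/-- `Δᵏ[n]'`, obtained from `Δᵏ[n]` by making thin all `(n - 1)`-simplices of its horn `Λᵏ[n]`.
The only non-degenerate ones that are not already thin in `Δᵏ[n]` are the faces `δ_{k-1}` and
`δ_{k+1}` (those of the two that exist). -/
def complicialSimplex' (n : ℕ) (k : Fin (n + 1)) : StratSet.{u} :=
  (complicialSimplex n k).addThin fun r => {α | r + 1 = n ∧ α ∈ (SSet.horn.{u} n k).obj _}

/-- `Δᵏ[n]''`, obtained from `Δᵏ[n]` by making all `(n - 1)`-simplices thin. -/
def complicialSimplex'' (n : ℕ) (k : Fin (n + 1)) : StratSet.{u} :=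
  (complicialSimplex n k).addThin fun r => {_α | r + 1 = n}

/-- The complicial thinness extension `Δᵏ[n]' ⊆ Δᵏ[n]''`. -/
def thinnessExtension (n : ℕ) (k : Fin (n + 1)) :
    complicialSimplex'.{u} n k ⟶ complicialSimplex''.{u} n k :=
  (complicialSimplex n k).addThinInclusion fun _ _ hα => hα.1

/-- A weak inner complicial set: it has the right lifting property with respect to the inner
(`0 < k < n`) complicial horn and thinness extensions. -/
structure IsWeakInnerComplicial (A : StratSet.{u}) : Prop where
  horn : ∀ (n : ℕ) (k : Fin (n + 1)), 1 ≤ n → 0 < (k : ℕ) → (k : ℕ) < n →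
    HasRLP (hornExtension n k) A
  thinness : ∀ (n : ℕ) (k : Fin (n + 1)), 2 ≤ n → 0 < (k : ℕ) → (k : ℕ) < n →
    HasRLP (thinnessExtension n k) A

/-- A weak complicial set: it has the right lifting property with respect to all complicial horn
extensions (`n ≥ 1`) and all complicial thinness extensions (`n ≥ 2`), inner and outer. -/
structure IsWeakComplicial (A : StratSet.{u}) : Prop where
  horn : ∀ (n : ℕ) (k : Fin (n + 1)), 1 ≤ n → HasRLP (hornExtension n k) A
  thinness : ∀ (n : ℕ) (k : Fin (n + 1)), 2 ≤ n → HasRLP (thinnessExtension n k) A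

/-- The alternating `n`-simplex of `E` that starts at the object `p` (`false` is `-` and `true`
is `+`); so `e⁻ₙ = - + - ⋯` is `alt false n` and `e⁺ₙ = + - + ⋯` is `alt true n`. Here `E` is the
generic simplicial equivalence, the nerve of the chaotic category on two objects. -/
def alt (p : Bool) (n : ℕ) : SSet.coherentIso.{u} _⦋n⦌ :=
  Codiscrete.equivFun.symm fun k : Fin (n + 1) => ULift.up (xor p (decide ((k : ℕ) % 2 = 1)))

/-- The underlying simplicial set of `E⁻ₙ` or `E⁺ₙ`: the simplicial subset of `E` generated by
`e⁻ₙ` or `e⁺ₙ`. -/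
def signedSubcomplex (p : Bool) (n : ℕ) : SSet.coherentIso.{u}.Subcomplex :=
  SSet.Subcomplex.ofSimplex (alt p n)

/-- The underlying simplicial set of `Eₙ`: the union of those of `E⁻ₙ` and `E⁺ₙ` in `E`. -/
def unionSubcomplex (n : ℕ) : SSet.coherentIso.{u}.Subcomplex :=
  signedSubcomplex false n ⊔ signedSubcomplex true n

/-- The generic simplicial equivalence `E` with its `0`-trivialised stratification: a simplex is
thin if and only if its dimension is positive. -/
def genericEquiv : StratSet.{u} := triv 0 (minimal SSet.coherentIso.{u})

/-- The stratified set `E⁻₁`: a simplex is thin if and only if its dimension is positive. -/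
def EMinusOne : StratSet.{u} := genericEquiv.regularSubset (signedSubcomplex false 1)

/-- The stratified set `E₂`: a simplex is thin if and only if its dimension is positive. -/
def ETwo : StratSet.{u} := genericEquiv.regularSubset (unionSubcomplex 2)

theorem signedSubcomplex_one_le : signedSubcomplex.{u} false 1 ≤ unionSubcomplex.{u} 2 := by
  refine le_trans ?_ (le_sup_left (b := signedSubcomplex true 2))
  rw [signedSubcomplex, SSet.Subcomplex.ofSimplex_le_iff, signedSubcomplex,
    SSet.Subcomplex.mem_ofSimplex_obj_iff]
  refine ⟨SimplexCategory.δ 2, Codiscrete.equivFun.injective ?_⟩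
  funext k
  fin_cases k <;> rfl

/-- The inclusion `E⁻₁ ⊆ E₂`. -/
def inclusionETwo : EMinusOne.{u} ⟶ ETwo.{u} :=
  genericEquiv.regularInclusionOfLE signedSubcomplex_one_le

/-- The thin `1`-simplices `v` and `w` of `A` are mutual equivalence inverses: there are thin
`2`-simplices `a`, with edges `v`, `w` and a degenerate one, and `a'`, with edges `w`, `v` and a
degenerate one. In Mathlib's indexing, a `2`-simplex has edges `δ 2 : 0 → 1`, `δ 0 : 1 → 2` and
`δ 1 : 0 → 2`, and a `1`-simplex `v` goes from `δ 1 v` to `δ 0 v`. -/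
structure AreEquivalenceInverses (A : StratSet.{u}) (v w : A.toSSet _⦋1⦌) : Prop where
  thin_left : v ∈ A.thin 1
  thin_right : w ∈ A.thin 1
  exists_left : ∃ a ∈ A.thin 2, A.toSSet.δ 2 a = v ∧ A.toSSet.δ 0 a = w ∧
    A.toSSet.δ 1 a = A.toSSet.σ 0 (A.toSSet.δ 1 v)
  exists_right : ∃ a' ∈ A.thin 2, A.toSSet.δ 2 a' = w ∧ A.toSSet.δ 0 a' = v ∧
    A.toSSet.δ 1 a' = A.toSSet.σ 0 (A.toSSet.δ 1 w)

end StratSet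

/-! A map out of `E₂` amounts to two composable-to-identity triangles sharing their edges, so
lifting against `E⁻₁ ⊆ E₂` is the same as finding an equivalence inverse for a thin edge. This is
checked on words in `-` and `+`: two faces of the generators agree only when the triangle relations
force them to (`act_triangle_eq`). It remains to compare `HasInverses` with the outer extensions.

If the outer extensions exist, filling `Λ⁰[2]` and `Λ²[2]` with a degenerate long edge gives every
thin edge a right and a left inverse (`exists_right_inverse`, `exists_left_inverse`), and
`exists_isTriangle_inverse` shows that the right inverse is also a left one.

Conversely, suppose thin edges are invertible. The argument is that of Joyal for special outer
horns. Write `Δ[m+2]` as the join of `Δ[1]` and `Δ[m]`. Then `Λ⁰[m+2]` is the union of the join of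
`Δ[1]` with `∂Δ[m]` and the join of the vertex `0` with `Δ[m]`. A horn is therefore an edge of the
slice of `A` over `∂Δ[m]` together with a lift of its source to the slice over `Δ[m]`, and a filler
is a lift of the edge with that source. Restriction maps between slices lift against the horns
`Λᵏ[r]` with `0 < k`, the case `k = r` needing the empty simplex to be in the smaller subcomplex
(`exists_sliceLift`). Such right fibrations reflect invertibility, and an invertible edge lifts with
prescribed source because its inverse lifts with prescribed target (`exists_lift_source`).

For the thinness extension at `0`, an inverse of the edge in the slice over `Δ[m]` is an
`(m+2)`-simplex whose face opposite `1` is the face in question, so the inner extension at `1`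
applies. The last vertex follows from the first by passage to the opposite. -/

namespace SSet

/-! ### Monotone maps acting on simplices -/

/-- The action of a monotone map on the simplices of a simplicial set. -/
def act (X : SSet.{u}) {a b : ℕ} (f : Fin (a + 1) →o Fin (b + 1)) (x : X _⦋b⦌) : X _⦋a⦌ :=
  X.map (SimplexCategory.mkHom f).op x

variable {X Y : SSet.{u}}

lemma act_act {a b c : ℕ} (f : Fin (a + 1) →o Fin (b + 1)) (g : Fin (b + 1) →o Fin (c + 1))
    (x : X _⦋c⦌) : X.act f (X.act g x) = X.act (g.comp f) x := by
  simp only [act]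
  rw [← CategoryTheory.comp_apply, ← Functor.map_comp]
  rfl

@[simp]
lemma act_id {a : ℕ} (x : X _⦋a⦌) : X.act OrderHom.id x = x := by
  change X.map (𝟙 _) x = x
  simp

lemma app_act (p : X ⟶ Y) {a b : ℕ} (f : Fin (a + 1) →o Fin (b + 1)) (x : X _⦋b⦌) :
    p.app _ (X.act f x) = Y.act f (p.app _ x) := by
  simp only [act]
  rw [← CategoryTheory.comp_apply, p.naturality]
  rfl

lemma δ_eq_act {n : ℕ} (i : Fin (n + 2)) (x : X _⦋n + 1⦌) :
    X.δ i x = X.act i.succAboveOrderEmb.toOrderHom x := rfl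

lemma σ_eq_act {n : ℕ} (i : Fin (n + 1)) (x : X _⦋n⦌) :
    X.σ i x = X.act ⟨i.predAbove, Fin.predAbove_right_monotone i⟩ x := rfl

lemma act_mem_degenerate {a b : ℕ} (f : Fin (a + 1) →o Fin (b + 1)) (hf : ¬ Function.Injective f)
    (x : X _⦋b⦌) : X.act f x ∈ X.degenerate a := by
  have : stdSimplex.objEquiv.symm (SimplexCategory.mkHom f) ∈ (Δ[b] : SSet.{u}).degenerate a := by
    rw [mem_degenerate_iff_notMem_nonDegenerate,
      stdSimplex.objEquiv_symm_mem_nonDegenerate_iff_mono, SimplexCategory.mono_iff_injective]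
    exact hf
  exact degenerate_app_apply this (yonedaEquiv.symm x)

end SSet

/-! ### Compatible families of simplices indexed by chains of a poset -/

/-- A family of simplices of `A`, indexed by the chains of `P` whose image lies in `K`, which is
compatible with the action of monotone maps. -/
@[ext]
structure PartialMap (A : SSet.{u}) (P : Type) [Preorder P] (K : Set (Set P)) : Type u where
  /-- the value at a chain -/
  val : ∀ (s : ℕ) (α : Fin (s + 1) →o P), Set.range α ∈ K → A _⦋s⦌
  val_comp : ∀ {s t : ℕ} (α : Fin (s + 1) →o P) (β : Fin (t + 1) →o Fin (s + 1))
    (h : Set.range α ∈ K) (h' : Set.range (α.comp β) ∈ K),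
    val t (α.comp β) h' = A.act β (val s α h)

namespace PartialMap

variable {A : SSet.{u}} {P Q : Type} [Preorder P] [Preorder Q] {K K' : Set (Set P)}

lemma val_congr (f : PartialMap A P K) {s : ℕ} {α β : Fin (s + 1) →o P} (h : α = β)
    (hα : Set.range α ∈ K) : f.val s α hα = f.val s β (h ▸ hα) := by
  subst h; rfl

/-- Restriction to fewer chains. -/
def res (f : PartialMap A P K) (h : K' ⊆ K) : PartialMap A P K' where
  val s α hα := f.val s α (h hα)
  val_comp α β _ _ := f.val_comp α β _ _

/-- Precomposition with a monotone map. -/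
def comap {L : Set (Set Q)} (f : PartialMap A Q L) (g : P →o Q)
    (h : ∀ S ∈ K, g '' S ∈ L) : PartialMap A P K where
  val s α hα := f.val s (g.comp α) (by
    have := h _ hα
    rwa [← Set.range_comp] at this)
  val_comp α β _ _ := f.val_comp (g.comp α) β _ _

/-- Gluing of a family of partial maps which agree on overlaps. -/
lemma exists_glue {I : Type*} {L : I → Set (Set P)} (hL : ∀ i, IsLowerSet (L i))
    (f : ∀ i, PartialMap A P (L i))
    (hf : ∀ i j s (α : Fin (s + 1) →o P) (hi : Set.range α ∈ L i) (hj : Set.range α ∈ L j),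
      (f i).val s α hi = (f j).val s α hj) :
    ∃ g : PartialMap A P (⋃ i, L i), ∀ i s (α : Fin (s + 1) →o P) (hi : Set.range α ∈ L i),
      g.val s α (Set.mem_iUnion_of_mem i hi) = (f i).val s α hi := by
  refine ⟨⟨fun s α hα => (f (Set.mem_iUnion.1 hα).choose).val s α (Set.mem_iUnion.1 hα).choose_spec,
    fun α β h h' => ?_⟩, fun i s α hi => hf _ _ _ _ _ _⟩
  -- The pieces chosen for `α` and for `α.comp β` may differ. Lower closure puts the second chain in
  -- the piece of the first as well, and agreement on overlaps does the rest.
  have hi := (Set.mem_iUnion.1 h).choose_spec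
  rw [← (f _).val_comp α β hi (hL _ (Set.range_comp_subset_range β α) hi)]
  exact hf _ _ _ _ _ _

/-- A partial map into a stratified set is stratified with respect to `Θ` if it takes the chains
whose image is in `Θ` to thin simplices. -/
def IsStrat {A : StratSet.{u}} (f : PartialMap A.toSSet P K) (Θ : Set (Set P)) : Prop :=
  ∀ s (α : Fin (s + 1) →o P) (h : Set.range α ∈ K), Set.range α ∈ Θ → f.val s α h ∈ A.thin s

end PartialMap

namespace StratSet

variable {A : StratSet.{u}}

lemma act_mem_thin {a b : ℕ} (f : Fin (a + 1) →o Fin (b + 1)) (hf : ¬ Function.Injective f)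
    (x : A.toSSet _⦋b⦌) : A.toSSet.act f x ∈ A.thin a :=
  A.degenerate_subset_thin _ (SSet.act_mem_degenerate f hf x)

end StratSet

/-- A monotone `α` with `α a = α b` is constant between `a` and `b`, so it is unchanged by
precomposition with the map `γ` that collapses that interval to `a`. Compatibility then exhibits the
value at `α` as degenerate. -/
lemma PartialMap.exists_val_eq_act {A : SSet.{u}} {P : Type} [PartialOrder P] {K : Set (Set P)}
    (f : PartialMap A P K) {s : ℕ} (α : Fin (s + 1) →o P) (h : Set.range α ∈ K)
    (hα : ¬ Function.Injective α) :
    ∃ γ : Fin (s + 1) →o Fin (s + 1), ¬ Function.Injective γ ∧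
      f.val s α h = A.act γ (f.val s α h) := by
  obtain ⟨a, b, hab, hlt⟩ : ∃ a b, α a = α b ∧ a < b := by
    simp only [Function.Injective, not_forall] at hα
    obtain ⟨a, b, h₁, h₂⟩ := hα
    obtain h | h := lt_or_gt_of_ne h₂
    · exact ⟨a, b, h₁, h⟩
    · exact ⟨b, a, h₁.symm, h⟩
  obtain ⟨γ, hγ'⟩ : ∃ γ : Fin (s + 1) →o Fin (s + 1),
      ∀ x, γ x = if a < x ∧ x ≤ b then a else x :=
    ⟨⟨fun x => if a < x ∧ x ≤ b then a else x, fun x y hxy => by grind⟩, fun _ => rfl⟩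
  have hγ : α.comp γ = α := by
    ext x
    simp only [OrderHom.comp_coe, Function.comp_apply, hγ']
    split_ifs with hx
    · exact le_antisymm (α.monotone hx.1.le) (hab ▸ α.monotone hx.2)
    · rfl
  refine ⟨γ, fun hinj => hlt.ne (hinj ?_), ?_⟩
  · simp [hγ', hlt]
  · rw [← f.val_comp α γ h (by rw [hγ]; exact h)]
    exact f.val_congr hγ.symm h

lemma PartialMap.val_mem_thin {A : StratSet.{u}} {P : Type} [PartialOrder P] {K : Set (Set P)}
    (f : PartialMap A.toSSet P K) {s : ℕ} (α : Fin (s + 1) →o P) (h : Set.range α ∈ K)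
    (hα : ¬ Function.Injective α) : f.val s α h ∈ A.thin s := by
  obtain ⟨γ, hγ, hf⟩ := f.exists_val_eq_act α h hα
  rw [hf]
  exact StratSet.act_mem_thin γ hγ _

/-! ### Complicial horn and thinness extensions in terms of simplices -/

namespace StratSet

variable {A : StratSet.{u}}

lemma mem_thin_complicialSimplex {n r : ℕ} (k : Fin (n + 1)) (β : Fin (r + 1) →o Fin (n + 1)) :
    (SSet.stdSimplex.objMk β : (Δ[n] : SSet.{u}) _⦋r⦌) ∈ (complicialSimplex.{u} n k).thin r ↔
      ¬ Function.Injective β ∨ (0 < r ∧ ∀ i : Fin (n + 1),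
      ((i : ℕ) + 1 = k ∨ (i : ℕ) = k ∨ (i : ℕ) = k + 1) → i ∈ Set.range β) := by
  refine or_congr ?_ Iff.rfl
  change _ ∈ (Δ[n] : SSet.{u}).degenerate r ↔ _
  rw [SSet.mem_degenerate_iff_notMem_nonDegenerate,
      SSet.stdSimplex.objEquiv_symm_mem_nonDegenerate_iff_mono, SimplexCategory.mono_iff_injective]
  rfl

lemma exists_objMk {n r : ℕ} (x : (Δ[n] : SSet.{u}) _⦋r⦌) :
    ∃ β : Fin (r + 1) →o Fin (n + 1), x = SSet.stdSimplex.objMk β :=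
  ⟨SSet.stdSimplex.asOrderHom x, rfl⟩

lemma objMk_mem_horn {n r : ℕ} (k : Fin (n + 1)) (β : Fin (r + 1) →o Fin (n + 1)) :
    (SSet.stdSimplex.objMk β : (Δ[n] : SSet.{u}) _⦋r⦌) ∈ (SSet.horn.{u} n k).obj _ ↔
      ∃ j, j ≠ k ∧ j ∉ Set.range β := by
  rw [SSet.mem_horn_iff_notMem_range]
  simp only [exists_prop]
  rfl

/-- The compatible family of simplices that describes a complicial horn in `A` has a filler. -/
lemma hornFiller {n : ℕ} {k : Fin (n + 1)} (hA : HasRLP (hornExtension n k) A)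
    (f : PartialMap A.toSSet (Fin (n + 1)) {S | ∃ j, j ≠ k ∧ j ∉ S})
    (hf : f.IsStrat {S | ∀ i : Fin (n + 1),
      ((i : ℕ) + 1 = k ∨ (i : ℕ) = k ∨ (i : ℕ) = k + 1) → i ∈ S}) :
    ∃ x : A.toSSet _⦋n⦌, (∀ (r : ℕ) (β : Fin (r + 1) →o Fin (n + 1)) h,
      A.toSSet.act β x = f.val r β h) ∧
      ∀ (r : ℕ) (β : Fin (r + 1) →o Fin (n + 1)), 0 < r → (∀ i : Fin (n + 1),
        ((i : ℕ) + 1 = k ∨ (i : ℕ) = k ∨ (i : ℕ) = k + 1) → i ∈ Set.range β) →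
        A.toSSet.act β x ∈ A.thin r := by
  let F : complicialHorn n k ⟶ A :=
    { toSSetHom :=
      { app m := ↾fun x => f.val m.unop.len (SSet.stdSimplex.asOrderHom x.1)
          ((objMk_mem_horn k _).1 x.2)
        naturality m m' φ := by
          ext x
          exact f.val_comp (SSet.stdSimplex.asOrderHom x.1) φ.unop.toOrderHom _ _ }
      map_thin r x hx := by
        obtain ⟨x, hx'⟩ := x
        obtain ⟨β, rfl⟩ := exists_objMk x
        obtain h | h := (mem_thin_complicialSimplex k β).1 hx
        · exact f.val_mem_thin β _ h
        · exact hf _ _ _ h.2 }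
  obtain ⟨G, hG⟩ := hA F
  let G' : Δ[n] ⟶ A.toSSet := G.toSSetHom
  refine ⟨G'.app _ (SSet.stdSimplex.objMk OrderHom.id), fun r β h => ?_, fun r β hr hβ => ?_⟩
  · rw [← SSet.app_act]
    have := congrArg (fun F => F.toSSetHom.app (Opposite.op ⦋r⦌)
      (⟨SSet.stdSimplex.objMk β, (objMk_mem_horn k β).2 h⟩ :
        (SSet.horn.{u} n k).obj (Opposite.op ⦋r⦌))) hG
    exact this
  · rw [← SSet.app_act]
    exact G.map_thin _ _ ((mem_thin_complicialSimplex k β).2 (Or.inr ⟨hr, hβ⟩))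

/-- The complicial thinness extension property, in terms of a simplex of `A`. -/
lemma act_mem_thin_of_thinnessExtension {n : ℕ} {k : Fin (n + 1)}
    (hA : HasRLP (thinnessExtension n k) A) (x : A.toSSet _⦋n⦌)
    (hx : ∀ (r : ℕ) (β : Fin (r + 1) →o Fin (n + 1)), 0 < r → (∀ i : Fin (n + 1),
        ((i : ℕ) + 1 = k ∨ (i : ℕ) = k ∨ (i : ℕ) = k + 1) → i ∈ Set.range β) →
        A.toSSet.act β x ∈ A.thin r)
    (hx' : ∀ (r : ℕ) (β : Fin (r + 1) →o Fin (n + 1)), 0 < r → r + 1 = n → Function.Injective β →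
      (∃ j, j ≠ k ∧ j ∉ Set.range β) → A.toSSet.act β x ∈ A.thin r)
    {r : ℕ} (hr : 0 < r) (hn : r + 1 = n) (β : Fin (r + 1) →o Fin (n + 1)) :
    A.toSSet.act β x ∈ A.thin r := by
  let F : complicialSimplex' n k ⟶ A :=
    { toSSetHom := SSet.yonedaEquiv.symm x
      map_thin r y hy := by
        obtain ⟨β, rfl⟩ := exists_objMk y
        by_cases hβ : Function.Injective β
        · obtain h | ⟨h, h'⟩ := hy
          · obtain h | h := (mem_thin_complicialSimplex k β).1 h
            · exact (h hβ).elim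
            · exact hx _ β h.1 h.2
          · exact hx' _ β h h'.1 hβ ((objMk_mem_horn k β).1 h'.2)
        · exact act_mem_thin β hβ x }
  obtain ⟨G, hG⟩ := hA F
  have hG' : G.toSSetHom = SSet.yonedaEquiv.symm x := congrArg Hom.toSSetHom hG
  have := G.map_thin r (SSet.stdSimplex.objMk β) (Or.inr ⟨hr, hn⟩)
  rw [hG'] at this
  exact this

end StratSet

namespace PartialMap

variable {A : SSet.{u}} {P : Type} [Preorder P]

lemma exists_glue₂ {K L : Set (Set P)} (hK : IsLowerSet K) (hL : IsLowerSet L)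
    (f : PartialMap A P K) (g : PartialMap A P L)
    (h : ∀ s (α : Fin (s + 1) →o P) (hα : Set.range α ∈ K) (hα' : Set.range α ∈ L),
      f.val s α hα = g.val s α hα') :
    ∃ e : PartialMap A P (K ∪ L),
      (∀ s (α : Fin (s + 1) →o P) (hα : Set.range α ∈ K), e.val s α (Or.inl hα) = f.val s α hα) ∧
      ∀ s (α : Fin (s + 1) →o P) (hα : Set.range α ∈ L), e.val s α (Or.inr hα) = g.val s α hα := by
  obtain ⟨e, he⟩ := exists_glue (L := fun b : Bool => cond b K L)
    (by rintro (_ | _); exacts [hL, hK])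
    (Bool.rec g f) (by
      rintro (_ | _) (_ | _) s α hi hj
      exacts [rfl, (h s α hj hi).symm, h s α hi hj, rfl])
  refine ⟨e.res (by rw [Set.union_eq_iUnion]), he true, he false⟩

end PartialMap

lemma Fin.range_eq_compl_of_injective {r n : ℕ} (hn : r + 1 = n) {β : Fin (r + 1) → Fin (n + 1)}
    (hβ : Function.Injective β) {j : Fin (n + 1)} (hj : j ∉ Set.range β) :
    Set.range β = {j}ᶜ := by
  have h : Finset.univ.image β ⊆ {j}ᶜ := by
    intro x hx
    simp only [Finset.mem_image, Finset.mem_univ, true_and] at hx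
    simp only [Finset.mem_compl, Finset.mem_singleton]
    rintro rfl
    exact hj hx
  have := Finset.eq_of_subset_of_card_le h (by
    rw [Finset.card_image_of_injective _ hβ, Finset.card_compl]
    simp [hn])
  have h2 := congrArg (fun s : Finset (Fin (n + 1)) => (s : Set (Fin (n + 1)))) this
  simpa using h2

/-! ### Extension of partial maps over one simplex along an inner horn -/

namespace StratSet

variable {A : StratSet.{u}} {P : Type} [PartialOrder P]

/-- A stratified partial map extends over a simplex which meets its domain in an inner complicial
horn. -/
lemma IsWeakInnerComplicial.exists_extend (hA : A.IsWeakInnerComplicial) {K Θ : Set (Set P)}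
    (hK : IsLowerSet K) (f : PartialMap A.toSSet P K) (hf : f.IsStrat Θ) {n : ℕ}
    (σ : Fin (n + 1) ↪o P) (k : Fin (n + 1)) (hk0 : 0 < (k : ℕ)) (hkn : (k : ℕ) < n)
    (hσ : ∀ S : Set (Fin (n + 1)), σ '' S ∈ K ↔ ∃ j, j ≠ k ∧ j ∉ S)
    (hΘ : ∀ S : Set (Fin (n + 1)),
      (∀ i : Fin (n + 1), ((i : ℕ) + 1 = k ∨ (i : ℕ) = k ∨ (i : ℕ) = k + 1) → i ∈ S) → σ '' S ∈ Θ)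
    (hΘ' : σ '' {k}ᶜ ∈ Θ → ∀ j, j ≠ k → σ '' {j}ᶜ ∈ Θ) :
    ∃ g : PartialMap A.toSSet P (K ∪ {S | S ⊆ Set.range σ}), g.IsStrat Θ ∧
      ∀ s (α : Fin (s + 1) →o P) (h : Set.range α ∈ K),
        g.val s α (Or.inl h) = f.val s α h := by
  let σ' : Fin (n + 1) →o P := σ.toOrderHom
  have hrange : ∀ {s : ℕ} (β : Fin (s + 1) →o Fin (n + 1)),
      Set.range (σ'.comp β) = σ '' Set.range β := fun β => Set.range_comp σ β
  let f' : PartialMap A.toSSet (Fin (n + 1)) {S | ∃ j, j ≠ k ∧ j ∉ S} :=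
    f.comap σ' fun S hS => (hσ S).2 hS
  -- By `hσ` the part of `f` on the image of `σ` is exactly a `k`-horn, and `hΘ` makes this horn
  -- stratified.
  obtain ⟨x, hx, hx'⟩ := hornFiller (hA.horn n k (by omega) hk0 hkn) f' (by
    intro s β h hβ
    exact hf _ _ _ ((hrange β).symm ▸ hΘ _ hβ))
  have hex : ∀ {s : ℕ} (α : Fin (s + 1) →o P), Set.range α ⊆ Set.range σ →
      ∃ β : Fin (s + 1) →o Fin (n + 1), σ'.comp β = α := by
    intro s α hα
    choose β hβ using fun i => hα (Set.mem_range_self i)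
    exact ⟨⟨β, fun i j hij => σ.le_iff_le.1 (by rw [hβ, hβ]; exact α.monotone hij)⟩,
      OrderHom.ext _ _ (funext hβ)⟩
  have hinj : ∀ {s : ℕ} {β γ : Fin (s + 1) →o Fin (n + 1)}, σ'.comp β = σ'.comp γ → β = γ := by
    intro s β γ h
    ext i : 2
    exact σ.injective (DFunLike.congr_fun h i)
  -- `b α` is the factorisation of `α` through `σ`; it is unique by `hinj`, which makes the values
  -- on the simplex compatible.
  choose! b hb using @hex
  let g : PartialMap A.toSSet P {S | S ⊆ Set.range σ} :=
    { val s α _ := A.toSSet.act (b α) x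
      val_comp α β h h' := by
        rw [SSet.act_act]
        congr 1
        apply hinj
        rw [hb _ h']
        conv_lhs => rw [← hb _ h]
        rfl }
  have hgK : ∀ s (α : Fin (s + 1) →o P) (hα : Set.range α ∈ K) (hα' : Set.range α ⊆ Set.range σ),
      f.val s α hα = A.toSSet.act (b α) x := by
    intro s α hα hα'
    have h1 : ∃ j, j ≠ k ∧ j ∉ Set.range (b α) := by
      refine (hσ _).1 ?_
      rw [← hrange, hb _ hα']
      exact hα
    rw [hx _ _ h1]
    exact f.val_congr (hb _ hα').symm _
  obtain ⟨e, he₁, he₂⟩ := PartialMap.exists_glue₂ hK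
    (fun S T hST hS => subset_trans hST hS) f g hgK
  refine ⟨e, ?_, he₁⟩
  intro s α hα hαΘ
  by_cases hαK : Set.range α ∈ K
  · rw [he₁ s α hαK]
    exact hf _ _ _ hαΘ
  have hασ : Set.range α ⊆ Set.range σ := hα.resolve_left hαK
  rw [he₂ s α hασ]
  change A.toSSet.act (b α) x ∈ _
  have hr : Set.range α = σ '' Set.range (b α) := by rw [← hrange, hb _ hασ]
  -- A chain outside `K` contains every vertex except possibly `k`. It is thus either onto, and thin
  -- because the filler is, or it runs through the face opposite `k`.
  have hmem : ∀ j, j ≠ k → j ∈ Set.range (b α) := by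
    intro j hj
    by_contra h
    exact hαK (by rw [hr]; exact (hσ _).2 ⟨j, hj, h⟩)
  by_cases hbα : Function.Injective (b α)
  swap
  · exact act_mem_thin _ hbα x
  have hs : 0 < s := by
    by_contra h
    obtain rfl : s = 0 := by omega
    obtain ⟨i, hi⟩ := hmem ⟨0, by omega⟩ (by rw [Ne, Fin.ext_iff]; exact hk0.ne)
    obtain ⟨j, hj⟩ := hmem ⟨n, by omega⟩ (by rw [Ne, Fin.ext_iff]; exact hkn.ne')
    rw [show i = j from Fin.ext (by omega), hj, Fin.ext_iff] at hi
    simp at hi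
    omega
  by_cases hkα : k ∈ Set.range (b α)
  · refine hx' _ _ hs fun i _ => ?_
    by_cases hik : i = k
    · exact hik ▸ hkα
    · exact hmem i hik
  · have hrk : Set.range (b α) = {k}ᶜ :=
      Set.Subset.antisymm (fun i hi => by rintro rfl; exact hkα hi) fun i hi => hmem i hi
    have hsn : s + 1 = n := by
      have h1 := Set.ncard_range_of_injective hbα
      rw [hrk, Set.ncard_compl] at h1
      simpa using h1.symm
    -- The face opposite `k` is in `Θ`, so by `hΘ'` all other faces are too. Those lie in the horn
    -- and are thin already, and the thinness extension yields the remaining one.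
    rw [hr, hrk] at hαΘ
    refine act_mem_thin_of_thinnessExtension (hA.thinness n k (by omega) hk0 hkn) x hx' ?_ hs hsn _
    rintro r β - hrn hβ ⟨j, hj, hjβ⟩
    rw [hx r β ⟨j, hj, hjβ⟩]
    refine hf _ _ _ ?_
    rw [hrange, Fin.range_eq_compl_of_injective hrn hβ hjβ]
    exact hΘ' hαΘ j hj

end StratSet

/-! ### Extension of partial maps over joins with `Δ[r]` -/

/-- The join of `Δ[r]` with the simplex on the linear order `M`. -/
abbrev JoinPoset (r : ℕ) (M : Type) : Type := Fin (r + 1) ⊕ₗ M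

namespace JoinPoset

variable {r : ℕ} {M : Type}

/-- The subsets of the join of `Δ[r]` and `M` whose part in `M` belongs to `C`. -/
def sieve (r : ℕ) (C : Set (Set M)) : Set (Set (JoinPoset r M)) := {S | Sum.inrₗ ⁻¹' S ∈ C}

/-- The subsets of the join of `Δ[r]` and `M` which contain at least two vertices of `Δ[r]`. -/
def nonconst (r : ℕ) (M : Type) : Set (Set (JoinPoset r M)) :=
  {S | ∃ i j, i ≠ j ∧ Sum.inlₗ i ∈ S ∧ Sum.inlₗ j ∈ S}

/-- The subsets of the join of `Δ[r]` and `M` whose part in `M` belongs to `C`, and whose part in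
`Δ[r]` belongs to the `k`-th horn. -/
def hornSieve (k : Fin (r + 1)) (C : Set (Set M)) : Set (Set (JoinPoset r M)) :=
  {S | Sum.inrₗ ⁻¹' S ∈ C ∧ ∃ i, i ≠ k ∧ Sum.inlₗ i ∉ S}

lemma isLowerSet_sieve {C : Set (Set M)} (hC : IsLowerSet C) : IsLowerSet (sieve r C) :=
  fun _ _ hST hS => hC (Set.preimage_mono hST) hS

lemma isLowerSet_hornSieve {C : Set (Set M)} (hC : IsLowerSet C) (k : Fin (r + 1)) :
    IsLowerSet (hornSieve k C) :=
  fun _ _ hST ⟨hS, i, hi, hiS⟩ => ⟨hC (Set.preimage_mono hST) hS, i, hi, fun h => hiS (hST h)⟩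

end JoinPoset

namespace StratSet

open JoinPoset

variable {A : StratSet.{u}} {r : ℕ} {M : Type} [LinearOrder M] [Finite M]

/-- The new simplices all lie in the join of `Δ[r]` with `τ`. By minimality of `τ`, a face of it
that omits a vertex of `τ` is over `C`, and one that omits a vertex of `Δ[r]` other than `k` is in
the horn part, so it meets the domain in its horn at `k`. This horn is inner: `0` precedes `k`, and
`k` is followed by the last vertex of `Δ[r]` or by a vertex of `τ`, which is non-empty when `∅ ∈ C`.
-/
lemma IsWeakInnerComplicial.exists_extend_join_of_insert (hA : A.IsWeakInnerComplicial)
    {C C' : Set (Set M)} (hC : IsLowerSet C) (hC' : IsLowerSet C')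
    {τ : Set M} (hτC : τ ∉ C) (hτC' : τ ∈ C') (hτ : ∀ τ', τ' ⊂ τ → τ' ∈ C)
    (k : Fin (r + 1)) (hk0 : 0 < (k : ℕ)) (hk : (k : ℕ) < r ∨ ∅ ∈ C)
    (f : PartialMap A.toSSet (JoinPoset r M) (hornSieve k C' ∪ sieve r C))
    (hf : f.IsStrat (nonconst r M)) :
    ∃ g : PartialMap A.toSSet (JoinPoset r M) (hornSieve k C' ∪ sieve r (insert τ C)),
      g.IsStrat (nonconst r M) ∧ ∀ s (α : Fin (s + 1) →o JoinPoset r M) h h',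
        g.val s α h = f.val s α h' := by
  classical
  have := Fintype.ofFinite M
  -- `U` is the vertex set of the join of `Δ[r]` with `τ`, and `σ` enumerates it in increasing
  -- order.
  let U : Finset (JoinPoset r M) := Finset.univ.filter fun x => ∀ m, x = Sum.inrₗ m → m ∈ τ
  have hU : ∀ x, x ∈ U ↔ ∀ m, x = Sum.inrₗ m → m ∈ τ := fun x => by simp [U]
  have hUl : ∀ i : Fin (r + 1), Sum.inlₗ i ∈ U := fun i => (hU _).2 (by rintro m ⟨⟩)
  obtain ⟨n, hn⟩ : ∃ n, U.card = n + 1 :=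
    Nat.exists_eq_succ_of_ne_zero (Finset.card_ne_zero_of_mem (hUl 0))
  let σ := U.orderEmbOfFin hn
  have hσU : Set.range σ = U := U.range_orderEmbOfFin hn
  have hσl : ∀ i : Fin (r + 1), ∃ j, σ j = Sum.inlₗ i := fun i => by
    change Sum.inlₗ i ∈ Set.range σ
    rw [hσU]; exact hUl i
  have hσr : ∀ m ∈ τ, ∃ j, σ j = Sum.inrₗ m := fun m hm => by
    change Sum.inrₗ m ∈ Set.range σ
    rw [hσU]; exact (hU _).2 (by rintro m' ⟨⟩; exact hm)
  have hσr' : ∀ j m, σ j = Sum.inrₗ m → m ∈ τ := fun j m h => by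
    have : σ j ∈ U := by
      rw [← Finset.mem_coe, ← hσU]; exact ⟨j, rfl⟩
    exact (hU _).1 this m h
  obtain ⟨k', hk'⟩ := hσl k
  have hk'0 : 0 < (k' : ℕ) := by
    obtain ⟨j, hj⟩ := hσl 0
    have : j < k' := by
      rw [← σ.lt_iff_lt, hj, hk', Sum.Lex.inl_lt_inl_iff]
      exact hk0
    exact lt_of_le_of_lt (Nat.zero_le _) this
  have hk'n : (k' : ℕ) < n := by
    suffices ∃ j, k' < j by
      obtain ⟨j, hj⟩ := this
      have h1 : (k' : ℕ) < j := hj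
      omega
    obtain hk | hk := hk
    · obtain ⟨j, hj⟩ := hσl (Fin.last r)
      refine ⟨j, ?_⟩
      rw [← σ.lt_iff_lt, hj, hk', Sum.Lex.inl_lt_inl_iff]
      exact hk
    · obtain ⟨m, hm⟩ : τ.Nonempty := by
        rw [Set.nonempty_iff_ne_empty]
        rintro rfl
        exact hτC hk
      obtain ⟨j, hj⟩ := hσr m hm
      refine ⟨j, ?_⟩
      rw [← σ.lt_iff_lt, hj, hk']
      exact Sum.Lex.inl_lt_inr _ _
  have himage : ∀ S : Set (Fin (n + 1)), Sum.inrₗ ⁻¹' (σ '' S) ⊆ τ := by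
    rintro S m ⟨j, -, hj⟩
    exact hσr' j m hj
  obtain ⟨g, hg, hg'⟩ := hA.exists_extend
    ((isLowerSet_hornSieve hC' k).union (isLowerSet_sieve hC)) f hf σ k' hk'0 hk'n
    (by
      intro S
      constructor
      · rintro (⟨-, i, hi, hiS⟩ | h)
        · obtain ⟨j, hj⟩ := hσl i
          refine ⟨j, ?_, fun hjS => hiS ⟨j, hjS, hj⟩⟩
          rintro rfl
          rw [hk'] at hj
          exact hi (Sum.inl_injective hj).symm
        · by_contra! hS
          refine hτC (hC (fun m hm => ?_) h)
          obtain ⟨j, hj⟩ := hσr m hm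
          refine ⟨j, hS j ?_, hj⟩
          rintro rfl
          rw [hk'] at hj
          cases hj
      · rintro ⟨j, hjk, hjS⟩
        have hj' : σ j ∉ σ '' S := fun ⟨j', h, h'⟩ => hjS (σ.injective h' ▸ h)
        rcases hσj : σ j with i | m
        · left
          refine ⟨hC' (himage S) hτC', i, ?_, ?_⟩
          · rintro rfl
            exact hjk (σ.injective (hσj.trans hk'.symm))
          · rw [hσj] at hj'; exact hj'
        · right
          refine hτ _ ⟨himage S, fun h => ?_⟩
          rw [hσj] at hj'
          exact hj' (h (hσr' j m hσj)))
    (by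
      intro S hS
      -- The predecessor of `k` in the join still lies in `Δ[r]`, so a simplex containing `k` and
      -- its neighbours has two vertices in `Δ[r]`.
      have h1 : (⟨k' - 1, by omega⟩ : Fin (n + 1)) < k' := by
        rw [Fin.lt_def]; dsimp only; omega
      have h2 := σ.lt_iff_lt.2 h1
      rw [hk'] at h2
      rcases hσj : σ ⟨k' - 1, by omega⟩ with i | m
      · rw [hσj] at h2
        refine ⟨i, k, (Sum.Lex.inl_lt_inl_iff.1 h2).ne, ⟨_, hS _ (Or.inl ?_), hσj⟩,
          ⟨k', hS _ (Or.inr (Or.inl rfl)), hk'⟩⟩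
        dsimp only; omega
      · rw [hσj] at h2
        exact (Sum.Lex.not_inr_lt_inl h2).elim)
    (by
      rintro ⟨i, j, hij, ⟨i', hi', hi⟩, ⟨j', hj', hj⟩⟩ l hl
      -- Here `k`, `i`, `j` are three distinct vertices of `Δ[r]`. Omitting a vertex other than `k`
      -- leaves `k` and at least one of `i`, `j`.
      have hij' : i' ≠ j' := by
        rintro rfl
        exact hij (Sum.inl_injective (hi.symm.trans hj))
      by_cases hil : i' = l
      · refine ⟨k, j, ?_, ⟨k', Ne.symm hl, hk'⟩, ⟨j', fun h => hij' (hil.trans h.symm), hj⟩⟩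
        rintro rfl
        exact hj' (σ.injective (hj.trans hk'.symm))
      · refine ⟨k, i, ?_, ⟨k', Ne.symm hl, hk'⟩, ⟨i', hil, hi⟩⟩
        rintro rfl
        exact hi' (σ.injective (hi.trans hk'.symm)))
  have hsub : hornSieve k C' ∪ sieve r (insert τ C) ⊆
      (hornSieve k C' ∪ sieve r C) ∪ {S | S ⊆ Set.range σ} := by
    rintro S (h | h | h)
    · exact Or.inl (Or.inl h)
    · right
      intro x hx
      rw [hσU]
      refine (hU _).2 ?_
      rintro m rfl
      rw [← h]; exact hx
    · exact Or.inl (Or.inr h)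
  exact ⟨g.res hsub, fun s α h h' => hg s α _ h', fun s α h h' => hg' s α h'⟩

/-- Induction on the number of subsets in `C'` but not in `C`. Adding a minimal one each time keeps
the family a lower set and makes the one-simplex extension applicable. -/
lemma IsWeakInnerComplicial.exists_extend_join (hA : A.IsWeakInnerComplicial)
    {C C' : Set (Set M)} (hC : IsLowerSet C) (hC' : IsLowerSet C') (hCC' : C ⊆ C')
    (k : Fin (r + 1)) (hk0 : 0 < (k : ℕ)) (hk : (k : ℕ) < r ∨ ∅ ∈ C)
    (f : PartialMap A.toSSet (JoinPoset r M) (hornSieve k C' ∪ sieve r C))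
    (hf : f.IsStrat (nonconst r M)) :
    ∃ g : PartialMap A.toSSet (JoinPoset r M) (sieve r C'),
      g.IsStrat (nonconst r M) ∧ ∀ s (α : Fin (s + 1) →o JoinPoset r M) h h',
        g.val s α h = f.val s α h' := by
  obtain ⟨d, hd⟩ : ∃ d, (C' \ C).ncard = d := ⟨_, rfl⟩
  induction d generalizing C with
  | zero =>
    rw [Set.ncard_eq_zero, Set.sdiff_eq_empty] at hd
    exact ⟨f.res fun S hS => Or.inr (hd hS), fun s α h h' => hf s α _ h', fun s α h h' => rfl⟩
  | succ d ih =>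
    have hne : (C' \ C).Nonempty := by
      rw [← Set.ncard_pos]; omega
    obtain ⟨τ, hτ⟩ := (Set.toFinite (C' \ C)).exists_minimal hne
    have hτmin : ∀ τ', τ' ⊂ τ → τ' ∈ C := by
      intro τ' h
      by_contra hτ'
      exact h.2 (hτ.2 ⟨hC' h.1 hτ.1.1, hτ'⟩ h.1)
    obtain ⟨g, hg, hg'⟩ := hA.exists_extend_join_of_insert hC hC' hτ.1.2 hτ.1.1 hτmin k hk0 hk f hf
    obtain ⟨e, he, he'⟩ := ih (C := insert τ C)
      (by
        rintro S T hTS (rfl | hS)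
        · by_cases h : T = S
          · exact Or.inl h
          · exact Or.inr (hτmin T ⟨hTS, fun h' => h (subset_antisymm hTS h')⟩)
        · exact Or.inr (hC hTS hS))
      (Set.insert_subset hτ.1.1 hCC') (hk.imp_right Or.inr) g hg
      (by
        have : C' \ insert τ C = (C' \ C) \ {τ} := by
          ext S; simp only [Set.mem_sdiff, Set.mem_insert_iff, Set.mem_singleton_iff]; tauto
        rw [this, Set.ncard_sdiff_singleton_of_mem hτ.1, hd]; rfl)
    refine ⟨e, he, fun s α h h' => ?_⟩
    have h'' : Set.range α ∈ hornSieve k C' ∪ sieve r (insert τ C) := h'.imp_right Or.inr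
    rw [he' s α h h'', hg' s α h'' h']

end StratSet

/-- Each `x` goes to the largest element of `T` below it, or to the minimum of `T` if there is none.
Such retractions stand in for inclusions of faces in the horn below, so that no face has to be
reindexed. -/
lemma Fin.exists_monotone_retraction {r : ℕ} {T : Set (Fin (r + 1))} (hT : T.Nonempty) :
    ∃ π : Fin (r + 1) →o Fin (r + 1), (∀ x, π x ∈ T) ∧ ∀ x ∈ T, π x = x := by
  classical
  let F := T.toFinset
  have hF : F.Nonempty := Set.toFinset_nonempty.2 hT
  let S (x : Fin (r + 1)) := F.filter fun y => y ≤ x ∨ y = F.min' hF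
  have hS : ∀ x, (S x).Nonempty := fun x =>
    ⟨F.min' hF, Finset.mem_filter.2 ⟨F.min'_mem hF, Or.inr rfl⟩⟩
  refine ⟨⟨fun x => (S x).max' (hS x), fun x y hxy => Finset.max'_subset (hS x) ?_⟩, fun x => ?_,
    fun x hx => ?_⟩
  · exact Finset.monotone_filter_right _ fun z _ => Or.imp_left fun h => h.trans hxy
  · exact Set.mem_toFinset.1 (Finset.mem_filter.1 ((S x).max'_mem (hS x))).1
  · change (S x).max' (hS x) = x
    refine le_antisymm (Finset.max'_le _ _ _ fun y hy => ?_) (Finset.le_max' (S x) x ?_)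
    · obtain h | rfl := (Finset.mem_filter.1 hy).2
      · exact h
      · exact F.min'_le _ (Set.mem_toFinset.2 hx)
    · exact Finset.mem_filter.2 ⟨Set.mem_toFinset.2 hx, Or.inl le_rfl⟩

/-! ### Slices of a stratified set and their restriction maps -/

namespace JoinPoset

variable {M : Type} [Preorder M]

/-- The map of joins induced by a monotone map. -/
def map (M : Type) [Preorder M] {a b : ℕ} (g : Fin (a + 1) →o Fin (b + 1)) :
    JoinPoset a M →o JoinPoset b M where
  toFun x := toLex (Sum.map g id (ofLex x))
  monotone' := by
    rintro (i | m) (j | m') h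
    · exact Sum.Lex.inl_le_inl_iff.2 (g.monotone (Sum.Lex.inl_le_inl_iff.1 h))
    · exact Sum.Lex.inl_le_inr _ _
    · exact (Sum.Lex.not_inr_le_inl h).elim
    · exact Sum.Lex.inr_le_inr_iff.2 (Sum.Lex.inr_le_inr_iff.1 h)

@[simp]
lemma map_inlₗ {a b : ℕ} (g : Fin (a + 1) →o Fin (b + 1)) (i : Fin (a + 1)) :
    map M g (Sum.inlₗ i) = Sum.inlₗ (g i) := rfl

lemma map_id {a : ℕ} : map M (OrderHom.id : Fin (a + 1) →o Fin (a + 1)) = OrderHom.id := by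
  ext (i | m) <;> rfl

lemma map_comp {a b c : ℕ} (g : Fin (b + 1) →o Fin (c + 1)) (f : Fin (a + 1) →o Fin (b + 1)) :
    map M (g.comp f) = (map M g).comp (map M f) := by
  ext (i | m) <;> rfl

lemma map_comp_eq_self {a s : ℕ} {g : Fin (a + 1) →o Fin (a + 1)} {α : Fin (s + 1) →o JoinPoset a M}
    (h : ∀ i, Sum.inlₗ i ∈ Set.range α → g i = i) : (map M g).comp α = α := by
  ext x : 2
  rcases hx : α x with i | m
  · simp only [OrderHom.comp_coe, Function.comp_apply, hx]
    exact congrArg Sum.inlₗ (h i ⟨x, hx⟩)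
  · simp only [OrderHom.comp_coe, Function.comp_apply, hx]
    rfl

lemma preimage_inrₗ_image_map {a b : ℕ} (g : Fin (a + 1) →o Fin (b + 1))
    (S : Set (JoinPoset a M)) :
    (Sum.inrₗ ⁻¹' (map M g '' S) : Set M) = Sum.inrₗ ⁻¹' S := by
  ext m
  constructor
  · rintro ⟨i | m', h, h'⟩
    · cases h'
    · cases h'; exact h
  · exact fun h => ⟨_, h, rfl⟩

lemma image_map_mem_sieve {a b : ℕ} (g : Fin (a + 1) →o Fin (b + 1)) {C : Set (Set M)}
    (S : Set (JoinPoset a M)) (hS : S ∈ sieve a C) : map M g '' S ∈ sieve b C := by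
  change _ ∈ C
  rw [preimage_inrₗ_image_map]
  exact hS

end JoinPoset

namespace StratSet

open JoinPoset

variable (A : StratSet.{u}) {M : Type} [LinearOrder M]

lemma _root_.PartialMap.IsStrat.comap_map {A : StratSet.{u}} {a b : ℕ} {C : Set (Set M)}
    {f : PartialMap A.toSSet (JoinPoset b M) (sieve b C)} (hf : f.IsStrat (nonconst b M))
    (g : Fin (a + 1) →o Fin (b + 1)) :
    (f.comap (map M g) (image_map_mem_sieve g)).IsStrat (nonconst a M) := by
  rintro s α h ⟨i, j, hij, ⟨i', hi⟩, ⟨j', hj⟩⟩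
  change f.val s ((map M g).comp α) _ ∈ _
  -- If `g` identifies the two vertices, the composite chain repeats a vertex and its value is
  -- degenerate. Otherwise it still has two distinct vertices in the simplex.
  by_cases hg : g i = g j
  · refine f.val_mem_thin _ _ fun hinj => hij ?_
    have : i' = j' := hinj (by
      simp only [OrderHom.comp_coe, Function.comp_apply, hi, hj, map_inlₗ, hg])
    rw [this, hj] at hi
    exact (Sum.inl_injective hi).symm
  · refine hf _ _ _ ⟨g i, g j, hg, ⟨i', ?_⟩, ⟨j', ?_⟩⟩
    · simp only [OrderHom.comp_coe, Function.comp_apply, hi, map_inlₗ]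
    · simp only [OrderHom.comp_coe, Function.comp_apply, hj, map_inlₗ]

/-- The simplicial set whose `r`-simplices are the maps to `A` from the join of `Δ[r]` with the
subcomplex `C` of the simplex on `M`, which take all simplices whose part in `Δ[r]` is not constant
to thin simplices. -/
def slice (C : Set (Set M)) : SSet.{u} where
  obj n := {f : PartialMap A.toSSet (JoinPoset n.unop.len M) (sieve _ C) // f.IsStrat (nonconst _ M)}
  map φ := ↾fun f => ⟨f.1.comap (map M φ.unop.toOrderHom) (image_map_mem_sieve _), f.2.comap_map _⟩
  map_id n := by
    ext f s α hα
    exact f.1.val_congr (by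
      change (map M OrderHom.id).comp α = α
      rw [map_id]; rfl) _
  map_comp φ ψ := by
    ext f s α hα
    exact f.1.val_congr (by
      change (map M (φ.unop.toOrderHom.comp ψ.unop.toOrderHom)).comp α = _
      rw [map_comp]; rfl) _

variable {A} {C C' : Set (Set M)}

/-- The partial map that underlies a simplex of the slice. -/
def sliceVal {r : ℕ} (y : (A.slice C) _⦋r⦌) : PartialMap A.toSSet (JoinPoset r M) (sieve r C) := y.1

/-- Constructor for the simplices of the slice. -/
def sliceMk {r : ℕ} (f : PartialMap A.toSSet (JoinPoset r M) (sieve r C))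
    (hf : f.IsStrat (nonconst r M)) : (A.slice C) _⦋r⦌ := ⟨f, hf⟩

lemma isStrat_sliceVal {r : ℕ} (y : (A.slice C) _⦋r⦌) : (sliceVal y).IsStrat (nonconst r M) := y.2

@[simp]
lemma sliceVal_sliceMk {r : ℕ} (f : PartialMap A.toSSet (JoinPoset r M) (sieve r C))
    (hf : f.IsStrat (nonconst r M)) : sliceVal (sliceMk f hf) = f := rfl

lemma slice_ext {r : ℕ} {y y' : (A.slice C) _⦋r⦌}
    (h : ∀ s (α : Fin (s + 1) →o JoinPoset r M) (hα : Set.range α ∈ sieve r C),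
      (sliceVal y).val s α hα = (sliceVal y').val s α hα) : y = y' := by
  refine Subtype.ext (PartialMap.ext ?_)
  funext s α hα
  exact h s α hα

lemma range_map_comp_mem_sieve {a b s : ℕ} (g : Fin (a + 1) →o Fin (b + 1))
    {α : Fin (s + 1) →o JoinPoset a M} (h : Set.range α ∈ sieve a C) :
    Set.range ((map M g).comp α) ∈ sieve b C := by
  have := image_map_mem_sieve g _ h
  rwa [← Set.range_comp] at this

lemma sliceVal_act {a b s : ℕ} (g : Fin (a + 1) →o Fin (b + 1)) (y : (A.slice C) _⦋b⦌)
    (α : Fin (s + 1) →o JoinPoset a M) (h : Set.range α ∈ sieve a C) :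
    (sliceVal ((A.slice C).act g y)).val s α h =
      (sliceVal y).val s ((map M g).comp α) (range_map_comp_mem_sieve g h) := rfl

/-- The restriction map between slices. -/
def sliceRes (h : C ⊆ C') : A.slice C' ⟶ A.slice C where
  app n := ↾fun f => ⟨f.1.res fun _ hS => h hS, fun s α hα => f.2 s α _⟩

lemma sliceVal_sliceRes (h : C ⊆ C') {r s : ℕ} (y : (A.slice C') _⦋r⦌)
    (α : Fin (s + 1) →o JoinPoset r M) (hα : Set.range α ∈ sieve r C) :
    (sliceVal ((sliceRes h).app _ y)).val s α hα = (sliceVal y).val s α (h hα) := rfl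

/-- The restriction maps between slices of a weak inner complicial set have the right lifting
property with respect to all horns except those of the first vertex. -/
lemma IsWeakInnerComplicial.exists_sliceLift [Finite M] (hA : A.IsWeakInnerComplicial)
    (hC : IsLowerSet C) (hC' : IsLowerSet C') (hCC' : C ⊆ C') {r : ℕ}
    (k : Fin (r + 1)) (hk0 : 0 < (k : ℕ)) (hk : (k : ℕ) < r ∨ ∅ ∈ C)
    (h : (SSet.horn r k : SSet.{u}) ⟶ A.slice C') (z : (A.slice C) _⦋r⦌)
    (hz : h ≫ sliceRes hCC' = (SSet.horn r k).ι ≫ SSet.yonedaEquiv.symm z) :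
    ∃ y : (A.slice C') _⦋r⦌, (SSet.horn r k).ι ≫ SSet.yonedaEquiv.symm y = h ∧
      (sliceRes hCC').app _ y = z := by
  let H {s : ℕ} (ρ : Fin (s + 1) →o Fin (r + 1)) (hρ : ∃ j, j ≠ k ∧ j ∉ Set.range ρ) :
      (A.slice C') _⦋s⦌ := h.app (Opposite.op ⦋s⦌)
        (⟨SSet.stdSimplex.objMk ρ, (objMk_mem_horn k ρ).2 hρ⟩ :
          (SSet.horn r k).obj (Opposite.op ⦋s⦌))
  have hH : ∀ {s t : ℕ} (ρ : Fin (s + 1) →o Fin (r + 1)) (hρ) (g : Fin (t + 1) →o Fin (s + 1)) hρ',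
      H (ρ.comp g) hρ' = (A.slice C').act g (H ρ hρ) := by
    intro s t ρ hρ g hρ'
    exact SSet.app_act h g (⟨SSet.stdSimplex.objMk ρ, (objMk_mem_horn k ρ).2 hρ⟩ :
          (SSet.horn r k).obj (Opposite.op ⦋s⦌))
  have hHz : ∀ {s : ℕ} (ρ : Fin (s + 1) →o Fin (r + 1)) (hρ),
      (sliceRes hCC').app _ (H ρ hρ) = (A.slice C).act ρ z := by
    intro s ρ hρ
    exact congrArg (fun F => F.app (Opposite.op ⦋s⦌)
        (⟨SSet.stdSimplex.objMk ρ, (objMk_mem_horn k ρ).2 hρ⟩ :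
          (SSet.horn r k).obj (Opposite.op ⦋s⦌))) hz
  -- The horn is covered by endomorphisms `θ` of `[r]` in place of faces. A chain whose
  -- `Δ[r]`-vertices are fixed by `θ` is evaluated on the simplex of the horn given by `θ`; the
  -- extra piece `none` carries `z`.
  let I := {θ : Fin (r + 1) →o Fin (r + 1) // (∃ j, j ≠ k ∧ j ∉ Set.range θ) ∧ θ k = k}
  let L : Option I → Set (Set (JoinPoset r M)) := fun o => o.elim (sieve r C) fun θ =>
    sieve r C' ∩ {S | ∀ i, Sum.inlₗ i ∈ S → θ.1 i = i}
  let f : ∀ o, PartialMap A.toSSet (JoinPoset r M) (L o) :=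
    Option.rec (sliceVal z) fun θ => (sliceVal (H θ.1 θ.2.1)).res Set.inter_subset_left
  have hIπ : ∀ (T : Set (Fin (r + 1))), (∃ j, j ≠ k ∧ j ∉ T) → ∃ θ : I, ∀ x ∈ T, θ.1 x = x := by
    rintro T ⟨j, hjk, hj⟩
    obtain ⟨π, hπ, hπ'⟩ := Fin.exists_monotone_retraction (T := {j}ᶜ) ⟨k, hjk.symm⟩
    refine ⟨⟨π, ⟨j, hjk, ?_⟩, hπ' _ hjk.symm⟩, fun x hx => hπ' _ ?_⟩
    · rintro ⟨x, hx⟩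
      exact hπ x hx
    · rintro rfl
      exact hj hx
  have hval : ∀ (θ : I) {s t : ℕ} (ρ : Fin (s + 1) →o Fin (r + 1)) hρ
      (α : Fin (t + 1) →o JoinPoset s M) (hα : Set.range α ∈ sieve s C'), (∀ i, θ.1 (ρ i) = ρ i) →
      (sliceVal (H ρ hρ)).val t α hα = (sliceVal (H θ.1 θ.2.1)).val t ((map M ρ).comp α)
        (range_map_comp_mem_sieve ρ hα) := by
    intro θ s t ρ hρ α hα hθ
    have h1 : θ.1.comp ρ = ρ := by
      ext i : 2; exact hθ i
    have h2 : H ρ hρ = (A.slice C').act ρ (H θ.1 θ.2.1) := by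
      rw [← hH θ.1 θ.2.1 ρ (by rw [h1]; exact hρ)]
      congr 1; exact h1.symm
    rw [h2, sliceVal_act]
  have hagree : ∀ i j s (α : Fin (s + 1) →o JoinPoset r M) (hi : Set.range α ∈ L i)
      (hj : Set.range α ∈ L j), (f i).val s α hi = (f j).val s α hj := by
    have key : ∀ (θ : I) s (α : Fin (s + 1) →o JoinPoset r M) (hi : Set.range α ∈ L (some θ))
      (hj : Set.range α ∈ sieve r C), (f (some θ)).val s α hi = (sliceVal z).val s α hj := by
      intro θ s α hi hj
      have h1 := sliceVal_sliceRes hCC' (H θ.1 θ.2.1) α hj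
      rw [hHz θ.1 θ.2.1] at h1
      refine h1.symm.trans ?_
      rw [sliceVal_act]
      exact PartialMap.val_congr _ (map_comp_eq_self hi.2) _
    rintro (_ | θ) (_ | θ') s α hi hj
    · rfl
    · exact (key θ' s α hj hi).symm
    · exact key θ s α hi hj
    -- Both `θ` and `θ'` fix the vertices of `α` and `k`, hence the image of the retraction `π` onto
    -- them, so both values equal the one computed from `π`. The vertex `k` is included because `α`
    -- may have no vertex in `Δ[r]`.
    · obtain ⟨π, hπ, hπ'⟩ := Fin.exists_monotone_retraction
        (T := insert k (Sum.inlₗ ⁻¹' Set.range α)) ⟨k, Or.inl rfl⟩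
      have h1 : ∀ θ : I, (∀ i, Sum.inlₗ i ∈ Set.range α → θ.1 i = i) → ∀ i, θ.1 (π i) = π i := by
        intro θ hθ i
        obtain h | h := hπ i
        · rw [h, θ.2.2]
        · exact hθ _ h
      have hπI : ∃ j, j ≠ k ∧ j ∉ Set.range π := by
        obtain ⟨j, hjk, hj'⟩ := θ.2.1
        refine ⟨j, hjk, ?_⟩
        rintro ⟨i, hi'⟩
        exact hj' ⟨π i, (h1 θ hi.2 i).trans hi'⟩
      have h2 : (map M π).comp α = α := map_comp_eq_self fun i hi' => hπ' i (Or.inr hi')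
      have h3 := fun (θ : I) (hθ : ∀ i, Sum.inlₗ i ∈ Set.range α → θ.1 i = i) =>
        (hval θ π hπI α hi.1 (h1 θ hθ)).trans (PartialMap.val_congr _ h2 _)
      exact (h3 θ hi.2).symm.trans (h3 θ' hj.2)
  obtain ⟨g, hg⟩ := PartialMap.exists_glue (L := L)
    (by
      rintro (_ | θ)
      · exact isLowerSet_sieve hC
      · exact (isLowerSet_sieve hC').inter fun S T hTS hS i hi => hS i (hTS hi)) f hagree
  have hgstrat : g.IsStrat (nonconst r M) := by
    intro s α hα hα'
    obtain ⟨o, ho⟩ := Set.mem_iUnion.1 hα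
    rw [hg o s α ho]
    rcases o with _ | θ
    · exact isStrat_sliceVal z s α ho hα'
    · exact isStrat_sliceVal (H θ.1 θ.2.1) s α ho.1 hα'
  have hsub : hornSieve k C' ∪ sieve r C ⊆ ⋃ o, L o := by
    rintro S (⟨hS, hS'⟩ | hS)
    · obtain ⟨θ, hθ⟩ := hIπ (Sum.inlₗ ⁻¹' S) hS'
      exact Set.mem_iUnion.2 ⟨some θ, hS, hθ⟩
    · exact Set.mem_iUnion.2 ⟨none, hS⟩
  -- By adjunction the lifting problem is now an extension problem in the join.
  obtain ⟨e, he, he'⟩ := hA.exists_extend_join hC hC' hCC' k hk0 hk (g.res hsub)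
    fun s α hα hα' => hgstrat s α _ hα'
  refine ⟨sliceMk e he, ?_, ?_⟩
  · ext ⟨⟨s⟩⟩ ⟨x, hx⟩
    obtain ⟨ρ, rfl⟩ := exists_objMk x
    have hρ := (objMk_mem_horn k ρ).1 hx
    change (A.slice C').act ρ (sliceMk e he) = H ρ hρ
    refine slice_ext fun t α hα => ?_
    obtain ⟨θ, hθ⟩ := hIπ (Set.range ρ) hρ
    rw [sliceVal_act, sliceVal_sliceMk, hval θ ρ hρ α hα fun i => hθ _ ⟨i, rfl⟩]
    have hmem : Set.range ((map M ρ).comp α) ∈ L (some θ) := by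
      refine ⟨range_map_comp_mem_sieve ρ hα, ?_⟩
      rintro i ⟨x, hx⟩
      rcases hαx : α x with j | m
      · simp only [OrderHom.comp_coe, Function.comp_apply, hαx] at hx
        exact hθ _ ⟨j, Sum.inl_injective hx⟩
      · simp only [OrderHom.comp_coe, Function.comp_apply, hαx] at hx
        cases hx
    have hmem' : Set.range ((map M ρ).comp α) ∈ hornSieve k C' ∪ sieve r C := by
      obtain ⟨j, hjk, hj⟩ := θ.2.1
      exact Or.inl ⟨hmem.1, j, hjk, fun h => hj ⟨j, hmem.2 j h⟩⟩
    rw [he' _ _ _ hmem']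
    exact hg (some θ) _ _ hmem
  · refine slice_ext fun t α hα => ?_
    rw [sliceVal_sliceRes, sliceVal_sliceMk]
    exact (he' _ _ _ (Or.inr hα)).trans (hg none _ _ hα)

end StratSet

/-! ### Horn lifting, triangles and inverses in simplicial sets -/

namespace SSet

variable {X Y Q : SSet.{u}}

/-- The right lifting property with respect to the horn `Λ[r, k]`, in terms of simplices. -/
def HornLift (p : X ⟶ Y) (r : ℕ) (k : Fin (r + 1)) : Prop :=
  ∀ (h : (horn r k : SSet.{u}) ⟶ X) (z : Y _⦋r⦌), h ≫ p = (horn r k).ι ≫ yonedaEquiv.symm z →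
    ∃ y : X _⦋r⦌, (horn r k).ι ≫ yonedaEquiv.symm y = h ∧ p.app _ y = z

lemma δ_comp_yonedaEquiv_symm {n : ℕ} (j : Fin (n + 2)) (x : X _⦋n + 1⦌) :
    stdSimplex.δ j ≫ yonedaEquiv.symm x = yonedaEquiv.symm (X.δ j x) :=
  yonedaEquiv_symm_naturality_left _ _

lemma HornLift.exists_of_isCompatible {p : X ⟶ Y} {n : ℕ} {i : Fin (n + 2)}
    (hp : HornLift p (n + 1) i) (x : Fin (n + 2) → X _⦋n⦌)
    (hx : horn.IsCompatible (i := i) fun j _ => yonedaEquiv.symm (x j)) (z : Y _⦋n + 1⦌)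
    (hz : ∀ j, j ≠ i → p.app _ (x j) = Y.δ j z) :
    ∃ y : X _⦋n + 1⦌, (∀ j, j ≠ i → X.δ j y = x j) ∧ p.app _ y = z := by
  obtain ⟨h, hh⟩ := hx.exists_desc
  obtain ⟨y, hy, hy'⟩ := hp h z (horn.hom_ext' fun j hj => by
    rw [← Category.assoc, hh j hj, ← Category.assoc, horn.ι_ι, δ_comp_yonedaEquiv_symm,
      yonedaEquiv_symm_comp, hz j hj])
  refine ⟨y, fun j hj => yonedaEquiv.symm.injective ?_, hy'⟩
  rw [← δ_comp_yonedaEquiv_symm, ← hh j hj, ← hy, ← Category.assoc, horn.ι_ι]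

lemma HornLift.exists₁₁ {p : X ⟶ Y} (hp : HornLift p 1 1) (x : X _⦋0⦌) (z : Y _⦋1⦌)
    (hz : p.app _ x = Y.δ 0 z) : ∃ y : X _⦋1⦌, X.δ 0 y = x ∧ p.app _ y = z := by
  obtain ⟨y, hy, hy'⟩ := HornLift.exists_of_isCompatible (n := 0) hp (fun _ => x) trivial z
    (fun j hj => by
      fin_cases j
      · exact hz
      · exact (hj rfl).elim)
  exact ⟨y, hy 0 (by decide), hy'⟩

lemma HornLift.exists₂₂ {p : X ⟶ Y} (hp : HornLift p 2 2) (x₀ x₁ : X _⦋1⦌)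
    (hx : X.δ 0 x₀ = X.δ 0 x₁) (z : Y _⦋2⦌) (hz₀ : p.app _ x₀ = Y.δ 0 z)
    (hz₁ : p.app _ x₁ = Y.δ 1 z) :
    ∃ y : X _⦋2⦌, X.δ 0 y = x₀ ∧ X.δ 1 y = x₁ ∧ p.app _ y = z := by
  obtain ⟨y, hy, hy'⟩ := HornLift.exists_of_isCompatible (n := 1) hp ![x₀, x₁, x₁]
    (by
      rw [horn.isCompatible_iff]
      intro j k hj hk hjk
      fin_cases j <;> fin_cases k
      all_goals try exact absurd hjk (by decide)
      all_goals try exact absurd rfl hk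
      exact (δ_comp_yonedaEquiv_symm _ _).trans ((congrArg _ hx).trans
        (δ_comp_yonedaEquiv_symm _ _).symm)) z
    (fun j hj => by
      fin_cases j
      · exact hz₀
      · exact hz₁
      · exact (hj rfl).elim)
  exact ⟨y, hy 0 (by decide), hy 1 (by decide), hy'⟩

/-- Horns `Λ[r, k]` in `X` have fillers. -/
def HornFill (X : SSet.{u}) (r : ℕ) (k : Fin (r + 1)) : Prop :=
  ∀ h : (horn r k : SSet.{u}) ⟶ X, ∃ y : X _⦋r⦌, (horn r k).ι ≫ yonedaEquiv.symm y = h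

lemma HornFill.exists_of_isCompatible {n : ℕ} {i : Fin (n + 2)}
    (hX : HornFill X (n + 1) i) (x : Fin (n + 2) → X _⦋n⦌)
    (hx : horn.IsCompatible (i := i) fun j _ => yonedaEquiv.symm (x j)) :
    ∃ y : X _⦋n + 1⦌, ∀ j, j ≠ i → X.δ j y = x j := by
  obtain ⟨h, hh⟩ := hx.exists_desc
  obtain ⟨y, hy⟩ := hX h
  refine ⟨y, fun j hj => yonedaEquiv.symm.injective ?_⟩
  rw [← δ_comp_yonedaEquiv_symm, ← hh j hj, ← hy, ← Category.assoc, horn.ι_ι]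

lemma HornFill.exists₃₁ (hX : HornFill X 3 1) (x₀ x₂ x₃ : X _⦋2⦌)
    (h₀₂ : X.δ 1 x₀ = X.δ 0 x₂) (h₀₃ : X.δ 2 x₀ = X.δ 0 x₃) (h₂₃ : X.δ 2 x₂ = X.δ 2 x₃) :
    ∃ y : X _⦋3⦌, X.δ 0 y = x₀ ∧ X.δ 2 y = x₂ ∧ X.δ 3 y = x₃ := by
  obtain ⟨y, hy⟩ := HornFill.exists_of_isCompatible (n := 2) hX ![x₀, x₂, x₂, x₃]
    (by
      rw [horn.isCompatible_iff]
      intro j k hj hk hjk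
      fin_cases j <;> fin_cases k
      all_goals try exact absurd hjk (by decide)
      all_goals try exact absurd rfl hj
      all_goals try exact absurd rfl hk
      · exact (δ_comp_yonedaEquiv_symm _ _).trans ((congrArg _ h₀₂).trans
          (δ_comp_yonedaEquiv_symm _ _).symm)
      · exact (δ_comp_yonedaEquiv_symm _ _).trans ((congrArg _ h₀₃).trans
          (δ_comp_yonedaEquiv_symm _ _).symm)
      · exact (δ_comp_yonedaEquiv_symm _ _).trans ((congrArg _ h₂₃).trans
          (δ_comp_yonedaEquiv_symm _ _).symm))
  exact ⟨y, hy 0 (by decide), hy 2 (by decide), hy 3 (by decide)⟩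

lemma HornFill.exists₃₂ (hX : HornFill X 3 2) (x₀ x₁ x₃ : X _⦋2⦌)
    (h₀₁ : X.δ 0 x₀ = X.δ 0 x₁) (h₀₃ : X.δ 2 x₀ = X.δ 0 x₃) (h₁₃ : X.δ 2 x₁ = X.δ 1 x₃) :
    ∃ y : X _⦋3⦌, X.δ 0 y = x₀ ∧ X.δ 1 y = x₁ ∧ X.δ 3 y = x₃ := by
  obtain ⟨y, hy⟩ := HornFill.exists_of_isCompatible (n := 2) hX ![x₀, x₁, x₁, x₃]
    (by
      rw [horn.isCompatible_iff]
      intro j k hj hk hjk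
      fin_cases j <;> fin_cases k
      all_goals try exact absurd hjk (by decide)
      all_goals try exact absurd rfl hj
      all_goals try exact absurd rfl hk
      · exact (δ_comp_yonedaEquiv_symm _ _).trans ((congrArg _ h₀₁).trans
          (δ_comp_yonedaEquiv_symm _ _).symm)
      · exact (δ_comp_yonedaEquiv_symm _ _).trans ((congrArg _ h₀₃).trans
          (δ_comp_yonedaEquiv_symm _ _).symm)
      · exact (δ_comp_yonedaEquiv_symm _ _).trans ((congrArg _ h₁₃).trans
          (δ_comp_yonedaEquiv_symm _ _).symm))
  exact ⟨y, hy 0 (by decide), hy 1 (by decide), hy 3 (by decide)⟩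

/-- `t` is a `2`-simplex with edges `f : 0 → 1`, `g : 1 → 2` and `h : 0 → 2`. -/
def IsTriangle (t : X _⦋2⦌) (f g h : X _⦋1⦌) : Prop :=
  X.δ 2 t = f ∧ X.δ 0 t = g ∧ X.δ 1 t = h

lemma isTriangle_σ_zero (f : X _⦋1⦌) : IsTriangle (X.σ 0 f) (X.σ 0 (X.δ 1 f)) f f := by
  refine ⟨?_, X.δ_comp_σ_self_apply 0 f, X.δ_comp_σ_succ_apply 0 f⟩
  exact X.δ_comp_σ_of_gt_apply (i := 1) (j := 0) (by decide) f

lemma isTriangle_σ_one (f : X _⦋1⦌) : IsTriangle (X.σ 1 f) f (X.σ 0 (X.δ 0 f)) f := by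
  refine ⟨X.δ_comp_σ_succ_apply 1 f, ?_, X.δ_comp_σ_self_apply 1 f⟩
  exact X.δ_comp_σ_of_le_apply (i := 0) (j := 0) (by decide) f

lemma IsTriangle.δ_eq {t : X _⦋2⦌} {f g h : X _⦋1⦌} (ht : IsTriangle t f g h) :
    X.δ 1 f = X.δ 1 h ∧ X.δ 0 f = X.δ 1 g ∧ X.δ 0 g = X.δ 0 h := by
  obtain ⟨rfl, rfl, rfl⟩ := ht
  refine ⟨?_, ?_, ?_⟩
  · exact X.δ_comp_δ_apply (i := 1) (j := 1) le_rfl t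
  · exact (X.δ_comp_δ_apply (i := 0) (j := 1) (by decide) t)
  · exact (X.δ_comp_δ_apply (i := 0) (j := 0) (by decide) t).symm

end SSet

namespace SSet

variable {X Y Q : SSet.{u}}

lemma app_δ (p : X ⟶ Y) {n : ℕ} (i : Fin (n + 2)) (x : X _⦋n + 1⦌) :
    p.app _ (X.δ i x) = Y.δ i (p.app _ x) := app_act p _ x

lemma app_σ (p : X ⟶ Y) {n : ℕ} (i : Fin (n + 1)) (x : X _⦋n⦌) :
    p.app _ (X.σ i x) = Y.σ i (p.app _ x) := app_act p ⟨i.predAbove, _⟩ x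

/-- The faces of a `3`-simplex with edges `a : 0 → 1`, `b : 1 → 2`, `c : 2 → 3`, `d : 0 → 2`,
`e : 1 → 3`, `g : 0 → 3`: the face opposite to `1` exists if the other ones do. -/
lemma HornFill.exists_isTriangle₃₁ (hX : HornFill X 3 1) {t₀ t₂ t₃ : X _⦋2⦌}
    {a b c d e g : X _⦋1⦌} (h₀ : IsTriangle t₀ b c e) (h₂ : IsTriangle t₂ a e g)
    (h₃ : IsTriangle t₃ a b d) : ∃ t, IsTriangle t d c g := by
  obtain ⟨y, rfl, rfl, rfl⟩ := hX.exists₃₁ t₀ t₂ t₃ (h₀.2.2.trans h₂.2.1.symm)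
    (h₀.1.trans h₃.2.1.symm) (h₂.1.trans h₃.1.symm)
  refine ⟨X.δ 1 y, ?_, ?_, ?_⟩
  · exact (X.δ_comp_δ_apply (i := 1) (j := 2) (by decide) y).symm.trans h₃.2.2
  · exact (X.δ_comp_δ_apply (i := 0) (j := 0) (by decide) y).trans h₀.2.1
  · exact (X.δ_comp_δ_apply (i := 1) (j := 1) (by decide) y).symm.trans h₂.2.2

/-- The faces of a `3`-simplex with edges `a : 0 → 1`, `b : 1 → 2`, `c : 2 → 3`, `d : 0 → 2`,
`e : 1 → 3`, `g : 0 → 3`: the face opposite to `2` exists if the other ones do. -/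
lemma HornFill.exists_isTriangle₃₂ (hX : HornFill X 3 2) {t₀ t₁ t₃ : X _⦋2⦌}
    {a b c d e g : X _⦋1⦌} (h₀ : IsTriangle t₀ b c e) (h₁ : IsTriangle t₁ d c g)
    (h₃ : IsTriangle t₃ a b d) : ∃ t, IsTriangle t a e g := by
  obtain ⟨y, rfl, rfl, rfl⟩ := hX.exists₃₂ t₀ t₁ t₃ (h₀.2.1.trans h₁.2.1.symm)
    (h₀.1.trans h₃.2.1.symm) (h₁.1.trans h₃.2.2.symm)
  refine ⟨X.δ 2 y, ?_, ?_, ?_⟩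
  · exact (X.δ_comp_δ_apply (i := 2) (j := 2) (by decide) y).symm.trans h₃.1
  · exact (X.δ_comp_δ_apply (i := 0) (j := 1) (by decide) y).trans h₀.2.2
  · exact (X.δ_comp_δ_apply (i := 1) (j := 1) (by decide) y).trans h₁.2.2

/-- If `g` has a right inverse `f` and a left inverse `h`, then it is a right inverse of `f`. -/
lemma exists_isTriangle_inverse (h₁ : HornFill X 3 1) (h₂ : HornFill X 3 2) {z₁ z₂ : X _⦋2⦌}
    {f g h : X _⦋1⦌} (hz₁ : IsTriangle z₁ g f (X.σ 0 (X.δ 0 f)))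
    (hz₂ : IsTriangle z₂ h g (X.σ 0 (X.δ 0 g))) :
    ∃ t, IsTriangle t f g (X.σ 0 (X.δ 1 f)) := by
  have e₁ : X.δ 0 g = X.δ 1 f := hz₁.δ_eq.2.1
  have e₂ : X.δ 0 h = X.δ 1 g := hz₂.δ_eq.2.1
  have e₃ : X.δ 1 g = X.δ 0 f := hz₁.δ_eq.1.trans (X.δ_comp_σ_succ_apply 0 _)
  rw [e₁] at hz₂
  rw [← e₃] at hz₁
  -- The `3`-simplex with spine `h`, `g`, `f` yields a homotopy from `f` to `h` with degenerate
  -- first edge. The next one moves the degenerate edge to the end, and the last replaces `h` by `f`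
  -- in `hz₂`.
  obtain ⟨t₁, ht₁⟩ := h₁.exists_isTriangle₃₁ hz₁ (e₂ ▸ isTriangle_σ_one h) hz₂
  obtain ⟨t₂, ht₂⟩ := h₁.exists_isTriangle₃₁ (isTriangle_σ_one f) ht₁ (isTriangle_σ_zero f)
  rw [← e₃] at ht₂
  exact h₂.exists_isTriangle₃₂ (isTriangle_σ_zero g) hz₂ ht₂

/-- A right inverse lifts along a right fibration. -/
lemma HornLift.exists_isTriangle {q : Y ⟶ Q} (hq : HornLift q 2 2) (f : Y _⦋1⦌) {w : Q _⦋1⦌}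
    {a : Q _⦋2⦌} (ha : IsTriangle a w (q.app _ f) (Q.σ 0 (Q.δ 1 w))) :
    ∃ (g : Y _⦋1⦌) (z : Y _⦋2⦌), IsTriangle z g f (Y.σ 0 (Y.δ 0 f)) ∧ q.app _ g = w := by
  have h1 : Q.δ 0 (q.app _ f) = Q.δ 1 w := ha.δ_eq.2.2.trans (Q.δ_comp_σ_self_apply 0 _)
  obtain ⟨z, hz₀, hz₁, hz⟩ := hq.exists₂₂ f (Y.σ 0 (Y.δ 0 f)) (Y.δ_comp_σ_self_apply 0 _).symm a
    ha.2.1.symm (by rw [app_σ, app_δ, h1]; exact ha.2.2.symm)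
  refine ⟨Y.δ 2 z, z, ⟨rfl, hz₀, hz₁⟩, ?_⟩
  rw [app_δ, hz]
  exact ha.1

/-- The edges of `Y` whose image in `Q` is invertible lift along a right fibration with target `Y`
when a lift of the source is given. -/
lemma HornLift.exists_lift_source {p : X ⟶ Y} {q : Y ⟶ Q} (hp₁ : HornLift p 1 1)
    (hp₂ : HornLift p 2 2) (hq : HornLift q 2 2) (hY₁ : HornFill Y 3 1) (hY₂ : HornFill Y 3 2)
    (f : Y _⦋1⦌) {w : Q _⦋1⦌} {a a' : Q _⦋2⦌}
    (ha : IsTriangle a (q.app _ f) w (Q.σ 0 (Q.δ 1 (q.app _ f))))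
    (ha' : IsTriangle a' w (q.app _ f) (Q.σ 0 (Q.δ 1 w)))
    (x : X _⦋0⦌) (hx : p.app _ x = Y.δ 1 f) :
    ∃ f' : X _⦋1⦌, p.app _ f' = f ∧ X.δ 1 f' = x := by
  -- A right fibration lifts inverses on one side only. Applying this to `f` and then to the
  -- resulting `g` gives `g` an inverse on each side, which makes `g` a two-sided inverse of `f`.
  obtain ⟨g, z₁, hz₁, hg⟩ := hq.exists_isTriangle f ha'
  rw [← hg] at ha
  obtain ⟨h, z₂, hz₂, -⟩ := hq.exists_isTriangle g ha
  obtain ⟨t, ht⟩ := exists_isTriangle_inverse hY₁ hY₂ hz₁ hz₂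
  -- The inverse `g` ends where `f` starts, so it lifts with target `x`. The remaining edge of a
  -- lift of `t` that extends `g'` and the degenerate edge at `x` is the required lift of `f`.
  obtain ⟨g', hg'₀, hg'⟩ := hp₁.exists₁₁ x g (hx.trans hz₁.δ_eq.2.1.symm)
  obtain ⟨t', ht'₀, ht'₁, ht'⟩ := hp₂.exists₂₂ g' (X.σ 0 x)
    (hg'₀.trans (X.δ_comp_σ_self_apply 0 _).symm) t (hg'.trans ht.2.1.symm)
    (by rw [app_σ, hx]; exact ht.2.2.symm)
  refine ⟨X.δ 2 t', ?_, ?_⟩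
  · rw [app_δ, ht']
    exact ht.1
  · refine (X.δ_comp_δ_apply (i := 1) (j := 1) (by decide) t').trans ?_
    refine (congrArg (X.δ 1) ht'₁).trans (X.δ_comp_σ_succ_apply 0 _)

end SSet

/-! ### Extension criteria, and the slice over the empty simplex -/

namespace StratSet

open JoinPoset

variable {A : StratSet.{u}}

/-- The converse of `hornFiller`: it lets extension properties be proved by constructing one
simplex. -/
lemma hasRLP_hornExtension_of {n : ℕ} {k : Fin (n + 1)}
    (H : ∀ f : PartialMap A.toSSet (Fin (n + 1)) {S | ∃ j, j ≠ k ∧ j ∉ S},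
      f.IsStrat {S | ∀ i : Fin (n + 1),
        ((i : ℕ) + 1 = k ∨ (i : ℕ) = k ∨ (i : ℕ) = k + 1) → i ∈ S} →
      ∃ x : A.toSSet _⦋n⦌, (∀ (r : ℕ) (β : Fin (r + 1) →o Fin (n + 1)) h,
        A.toSSet.act β x = f.val r β h) ∧
        ∀ (r : ℕ) (β : Fin (r + 1) →o Fin (n + 1)), 0 < r → (∀ i : Fin (n + 1),
          ((i : ℕ) + 1 = k ∨ (i : ℕ) = k ∨ (i : ℕ) = k + 1) → i ∈ Set.range β) →
          A.toSSet.act β x ∈ A.thin r) :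
    HasRLP (hornExtension n k) A := by
  intro F
  let F' : (SSet.horn n k : SSet.{u}) ⟶ A.toSSet := F.toSSetHom
  let f : PartialMap A.toSSet (Fin (n + 1)) {S | ∃ j, j ≠ k ∧ j ∉ S} :=
    { val s β hβ := F'.app (Opposite.op ⦋s⦌)
        (⟨SSet.stdSimplex.objMk β, (objMk_mem_horn k β).2 hβ⟩ :
          (SSet.horn n k).obj (Opposite.op ⦋s⦌))
      val_comp {s t} α β h h' := SSet.app_act F' β
        (⟨SSet.stdSimplex.objMk α, (objMk_mem_horn k α).2 h⟩ :
          (SSet.horn n k).obj (Opposite.op ⦋s⦌)) }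
  obtain ⟨x, hx, hx'⟩ := H f (by
    intro s β h hβ
    by_cases hs : 0 < s
    · exact F.map_thin s _ ((mem_thin_complicialSimplex k β).2 (Or.inr ⟨hs, hβ⟩))
    · obtain rfl : s = 0 := by omega
      exfalso
      -- The horn is non-empty, so `n ≠ 0` and `k` has a neighbour. A single vertex cannot contain
      -- both.
      have hj : ∃ j : Fin (n + 1), j ≠ k ∧ ((j : ℕ) + 1 = k ∨ (j : ℕ) = k ∨ (j : ℕ) = k + 1) := by
        obtain ⟨j, hj, -⟩ := h
        have hn : n ≠ 0 := by
          rintro rfl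
          exact hj (Fin.ext (by omega))
        by_cases hk : (k : ℕ) = 0
        · exact ⟨⟨1, by omega⟩, by rw [Ne, Fin.ext_iff]; dsimp only; omega, by
            dsimp only; omega⟩
        · exact ⟨⟨k - 1, by omega⟩, by rw [Ne, Fin.ext_iff]; dsimp only; omega, by
            dsimp only; omega⟩
      obtain ⟨j, hjk, hj⟩ := hj
      obtain ⟨a, ha⟩ := hβ j hj
      obtain ⟨b, hb⟩ := hβ k (Or.inr (Or.inl rfl))
      rw [show a = b from Fin.ext (by omega), hb] at ha
      exact hjk ha.symm)
  refine ⟨⟨SSet.yonedaEquiv.symm x, fun s y hy => ?_⟩, ?_⟩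
  · obtain ⟨β, rfl⟩ := exists_objMk y
    obtain h | h := (mem_thin_complicialSimplex k β).1 hy
    · exact act_mem_thin β h x
    · exact hx' s β h.1 h.2
  · refine Hom.ext ?_
    ext ⟨⟨s⟩⟩ ⟨y, hy⟩
    obtain ⟨β, rfl⟩ := exists_objMk y
    exact hx s β ((objMk_mem_horn k β).1 hy)

/-- Apart from degenerate simplices, the face opposite `k` is the only `(n - 1)`-simplex whose
thinness is not part of the data: any other one misses a vertex different from `k`. -/
lemma hasRLP_thinnessExtension_of {n : ℕ} {k : Fin (n + 1)} (hn : 2 ≤ n)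
    (H : ∀ x : A.toSSet _⦋n⦌,
      (∀ (r : ℕ) (β : Fin (r + 1) →o Fin (n + 1)), 0 < r → (∀ i : Fin (n + 1),
        ((i : ℕ) + 1 = k ∨ (i : ℕ) = k ∨ (i : ℕ) = k + 1) → i ∈ Set.range β) →
        A.toSSet.act β x ∈ A.thin r) →
      (∀ (r : ℕ) (β : Fin (r + 1) →o Fin (n + 1)), r + 1 = n →
        (∃ j, j ≠ k ∧ j ∉ Set.range β) → A.toSSet.act β x ∈ A.thin r) →
      ∀ (r : ℕ) (β : Fin (r + 1) →o Fin (n + 1)), r + 1 = n → Function.Injective β →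
        k ∉ Set.range β → A.toSSet.act β x ∈ A.thin r) :
    HasRLP (thinnessExtension n k) A := by
  intro F
  let F' : (Δ[n] : SSet.{u}) ⟶ A.toSSet := F.toSSetHom
  let x : A.toSSet _⦋n⦌ := F'.app (Opposite.op ⦋n⦌) (SSet.stdSimplex.objMk OrderHom.id)
  have hx : ∀ (r : ℕ) (β : Fin (r + 1) →o Fin (n + 1)),
      F'.app (Opposite.op ⦋r⦌) (SSet.stdSimplex.objMk β) = A.toSSet.act β x := fun r β =>
    SSet.app_act F' β (SSet.stdSimplex.objMk OrderHom.id)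
  have h₂ : ∀ (r : ℕ) (β : Fin (r + 1) →o Fin (n + 1)), r + 1 = n →
        (∃ j, j ≠ k ∧ j ∉ Set.range β) → A.toSSet.act β x ∈ A.thin r := by
    intro r β hr hβ
    rw [← hx]
    exact F.map_thin r _ (Or.inr ⟨by omega, hr, (objMk_mem_horn k β).2 hβ⟩)
  refine ⟨⟨F', fun r y hy => ?_⟩, Hom.ext rfl⟩
  obtain ⟨β, rfl⟩ := exists_objMk y
  obtain h | ⟨-, h⟩ := hy
  · exact F.map_thin r _ (Or.inl h)
  · refine (congrArg (· ∈ A.thin r) (hx r β)).mpr ?_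
    by_cases hβ : Function.Injective β
    swap
    · exact act_mem_thin β hβ x
    by_cases hβ' : ∃ j, j ≠ k ∧ j ∉ Set.range β
    · exact h₂ r β h hβ'
    · refine H x (fun r β hr hβ => ?_) h₂ r β h hβ fun hk => ?_
      · rw [← hx]
        exact F.map_thin r _ (Or.inl ((mem_thin_complicialSimplex k β).2 (Or.inr ⟨hr, hβ⟩)))
      · push Not at hβ'
        have hsurj : Function.Surjective β := fun j => by
          by_cases hj : j = k
          · exact hj ▸ hk
          · exact hβ' j hj
        have := Fintype.card_le_of_surjective β hsurj
        simp only [Fintype.card_fin] at this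
        change r + 1 = n at h
        omega

variable {M : Type} [LinearOrder M] {C C' : Set (Set M)}

lemma IsWeakInnerComplicial.hornLift_sliceRes [Finite M] (hA : A.IsWeakInnerComplicial)
    (hC : IsLowerSet C) (hC' : IsLowerSet C') (hCC' : C ⊆ C') {r : ℕ}
    (k : Fin (r + 1)) (hk0 : 0 < (k : ℕ)) (hk : (k : ℕ) < r ∨ ∅ ∈ C) :
    SSet.HornLift (A.sliceRes hCC') r k :=
  fun h z hz => hA.exists_sliceLift hC hC' hCC' k hk0 hk h z hz

lemma IsWeakInnerComplicial.hornFill_slice [Finite M] (hA : A.IsWeakInnerComplicial)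
    (hC : IsLowerSet C) {r : ℕ} (k : Fin (r + 1)) (hk0 : 0 < (k : ℕ)) (hk : (k : ℕ) < r) :
    SSet.HornFill (A.slice C) r k := by
  intro h
  -- No chain lies over the empty family, so this slice is a point and lifting over it is plain horn
  -- filling.
  let z : (A.slice (∅ : Set (Set M))) _⦋r⦌ :=
    sliceMk ⟨fun _ _ h => h.elim, fun _ _ h => h.elim⟩ fun _ _ h => h.elim
  obtain ⟨y, hy, -⟩ := hA.exists_sliceLift isLowerSet_empty hC (Set.empty_subset _) k hk0
    (Or.inl hk) h z (by
      ext ⟨⟨s⟩⟩ x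
      exact slice_ext fun t α hα => hα.elim)
  exact ⟨y, hy⟩

/-- The inclusion of `Δ[r]` in its join with `M`. -/
def inlHom (r : ℕ) (M : Type) [LinearOrder M] : Fin (r + 1) →o JoinPoset r M :=
  ⟨Sum.inlₗ, fun _ _ h => Sum.Lex.inl_le_inl_iff.2 h⟩

/-- A retraction of the inclusion of `Δ[r]` in its join with `M`. -/
def projHom (r : ℕ) (M : Type) [LinearOrder M] : JoinPoset r M →o Fin (r + 1) where
  toFun x := Sum.elim id (fun _ => Fin.last r) (ofLex x)
  monotone' := by
    rintro (i | m) (j | m') h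
    · exact Sum.Lex.inl_le_inl_iff.1 h
    · exact Fin.le_last i
    · exact (Sum.Lex.not_inr_le_inl h).elim
    · exact le_rfl

lemma range_inlHom_mem (r : ℕ) (h : ∅ ∈ C) : Set.range (inlHom r M) ∈ sieve r C := by
  change _ ∈ C
  convert h
  ext m
  simp only [Set.mem_preimage, Set.mem_range, Set.mem_empty_iff_false, iff_false]
  rintro ⟨i, hi⟩
  cases hi

lemma inlHom_comp_projHom {r s : ℕ} {α : Fin (s + 1) →o JoinPoset r M}
    (hα : Set.range α ∈ sieve r ({∅} : Set (Set M))) :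
    (inlHom r M).comp ((projHom r M).comp α) = α := by
  ext x : 2
  rcases hx : α x with i | m
  · simp only [OrderHom.comp_coe, Function.comp_apply, hx]
    rfl
  · have : m ∈ (∅ : Set M) := by
      rw [← show _ = ∅ from hα]
      exact ⟨x, hx⟩
    exact this.elim

/-- The simplex of `A` that underlies a simplex of the slice over a point. -/
def sliceEval {r : ℕ} (y : (A.slice ({∅} : Set (Set M))) _⦋r⦌) : A.toSSet _⦋r⦌ :=
  (sliceVal y).val r (inlHom r M) (range_inlHom_mem r rfl)

lemma sliceEval_act {a b : ℕ} (g : Fin (a + 1) →o Fin (b + 1))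
    (y : (A.slice ({∅} : Set (Set M))) _⦋b⦌) :
    sliceEval ((A.slice ({∅} : Set (Set M))).act g y) = A.toSSet.act g (sliceEval y) :=
  (sliceVal y).val_comp (inlHom b M) g _ _

lemma sliceEval_injective {r : ℕ} :
    Function.Injective (sliceEval : (A.slice ({∅} : Set (Set M))) _⦋r⦌ → A.toSSet _⦋r⦌) := by
  intro y y' h
  refine slice_ext fun s α hα => ?_
  have key : ∀ y : (A.slice ({∅} : Set (Set M))) _⦋r⦌,
      (sliceVal y).val s α hα = A.toSSet.act ((projHom r M).comp α) (sliceEval y) := by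
    intro y
    refine ((sliceVal y).val_congr (inlHom_comp_projHom hα).symm _).trans ?_
    exact (sliceVal y).val_comp _ _ _ _
  rw [key, key, h]

/-- The join of `Δ[r]` with the empty simplex is `Δ[r]`, so the slice over `{∅}` consists of the
simplices of `A` all of whose non-constant faces are thin. Thin edges, and thin triangles with thin
edges, belong to it. -/
lemma exists_sliceEval_eq (M : Type) [LinearOrder M] {r : ℕ} (x : A.toSSet _⦋r⦌)
    (hx : ∀ (s : ℕ) (β : Fin (s + 1) →o Fin (r + 1)), (∃ i j, β i ≠ β j) →
      A.toSSet.act β x ∈ A.thin s) :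
    ∃ y : (A.slice ({∅} : Set (Set M))) _⦋r⦌, sliceEval y = x := by
  refine ⟨sliceMk ⟨fun s α _ => A.toSSet.act ((projHom r M).comp α) x, fun α β _ _ => ?_⟩ ?_, ?_⟩
  · rw [SSet.act_act]; rfl
  · rintro s α hα ⟨i, j, hij, ⟨i', hi⟩, ⟨j', hj⟩⟩
    refine hx _ _ ⟨i', j', ?_⟩
    simp only [OrderHom.comp_coe, Function.comp_apply, hi, hj]
    exact hij
  · exact SSet.act_id x

lemma isTriangle_of_sliceEval {t : (A.slice ({∅} : Set (Set M))) _⦋2⦌}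
    {f g h : (A.slice ({∅} : Set (Set M))) _⦋1⦌}
    (H : SSet.IsTriangle (sliceEval t) (sliceEval f) (sliceEval g) (sliceEval h)) :
    SSet.IsTriangle t f g h :=
  ⟨sliceEval_injective ((sliceEval_act _ t).trans H.1),
    sliceEval_injective ((sliceEval_act _ t).trans H.2.1),
    sliceEval_injective ((sliceEval_act _ t).trans H.2.2)⟩

lemma sliceEval_mem_thin (f : (A.slice ({∅} : Set (Set M))) _⦋1⦌) : sliceEval f ∈ A.thin 1 :=
  isStrat_sliceVal f 1 _ _ ⟨0, 1, by decide, ⟨0, rfl⟩, ⟨1, rfl⟩⟩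

lemma act_mem_thin_of_edge {f : A.toSSet _⦋1⦌} (hf : f ∈ A.thin 1) (s : ℕ)
    (β : Fin (s + 1) →o Fin (1 + 1)) (hβ : ∃ i j, β i ≠ β j) : A.toSSet.act β f ∈ A.thin s := by
  by_cases hinj : Function.Injective β
  swap
  · exact act_mem_thin β hinj f
  obtain ⟨i, j, hij⟩ := hβ
  have h1 := Fintype.card_le_of_injective β hinj
  simp only [Fintype.card_fin] at h1
  obtain rfl : s = 1 := by
    by_contra hs
    obtain rfl : s = 0 := by omega
    exact hij (congrArg β (Fin.ext (by omega)))
  have h2 : β = OrderHom.id := by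
    have h3 : β 0 < β 1 := lt_of_le_of_ne (β.monotone (by decide)) (hinj.ne (by decide))
    ext x
    fin_cases x
    · change (β 0 : ℕ) = 0
      omega
    · change (β 1 : ℕ) = 1
      omega
  rw [h2, SSet.act_id]
  exact hf

lemma act_mem_thin_of_triangle {t : A.toSSet _⦋2⦌} (ht : t ∈ A.thin 2)
    (ht' : ∀ i, A.toSSet.δ i t ∈ A.thin 1) (s : ℕ)
    (β : Fin (s + 1) →o Fin (2 + 1)) (hβ : ∃ i j, β i ≠ β j) : A.toSSet.act β t ∈ A.thin s := by
  by_cases hinj : Function.Injective β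
  swap
  · exact act_mem_thin β hinj t
  by_cases hsurj : Function.Surjective β
  · have h1 := Fintype.card_of_bijective ⟨hinj, hsurj⟩
    simp only [Fintype.card_fin] at h1
    obtain rfl : s = 2 := by omega
    have h3 : β 0 < β 1 := lt_of_le_of_ne (β.monotone (by decide)) (hinj.ne (by decide))
    have h4 : β 1 < β 2 := lt_of_le_of_ne (β.monotone (by decide)) (hinj.ne (by decide))
    have h2 : β = OrderHom.id := by
      ext x
      fin_cases x
      · change (β 0 : ℕ) = 0
        omega
      · change (β 1 : ℕ) = 1
        omega
      · change (β 2 : ℕ) = 2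
        omega
    rw [h2, SSet.act_id]
    exact ht
  · obtain ⟨i, hi⟩ := not_forall.1 hsurj
    have hγ : ∀ x, β x ≠ i := fun x hx => hi ⟨x, hx⟩
    choose γ hγ using fun x => Fin.exists_succAbove_eq (hγ x)
    have h1 : A.toSSet.act β t = A.toSSet.act ⟨γ, fun x y hxy =>
        (Fin.succAboveOrderEmb i).le_iff_le.1 (by
          simp only [Fin.succAboveOrderEmb_apply, hγ]
          exact β.monotone hxy)⟩ (A.toSSet.δ i t) := by
      rw [SSet.δ_eq_act, SSet.act_act]
      congr 1
      ext x : 2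
      exact (hγ x).symm
    rw [h1]
    refine act_mem_thin_of_edge (ht' i) _ _ ?_
    obtain ⟨x, y, hxy⟩ := hβ
    refine ⟨x, y, fun h => hxy ?_⟩
    rw [← hγ x, ← hγ y]
    exact congrArg i.succAbove h

lemma AreEquivalenceInverses.exists_slice (M : Type) [LinearOrder M]
    (f : (A.slice ({∅} : Set (Set M))) _⦋1⦌) {w : A.toSSet _⦋1⦌}
    (h : A.AreEquivalenceInverses (sliceEval f) w) :
    ∃ (g : (A.slice ({∅} : Set (Set M))) _⦋1⦌) (t t' : (A.slice ({∅} : Set (Set M))) _⦋2⦌),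
      SSet.IsTriangle t f g ((A.slice ({∅} : Set (Set M))).σ 0 ((A.slice _).δ 1 f)) ∧
      SSet.IsTriangle t' g f ((A.slice ({∅} : Set (Set M))).σ 0 ((A.slice _).δ 1 g)) := by
  obtain ⟨hv, hw, ⟨a, ha, ha₂, ha₀, ha₁⟩, ⟨a', ha', ha'₂, ha'₀, ha'₁⟩⟩ := h
  have hσ : ∀ x, A.toSSet.σ 0 x ∈ A.thin 1 := fun x =>
    A.degenerate_subset_thin _ (A.toSSet.σ_mem_degenerate _ _)
  obtain ⟨g, rfl⟩ := exists_sliceEval_eq M w (act_mem_thin_of_edge hw)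
  obtain ⟨t, rfl⟩ := exists_sliceEval_eq M a (act_mem_thin_of_triangle ha (by
    intro i
    fin_cases i
    · exact ha₀ ▸ hw
    · exact ha₁ ▸ hσ _
    · exact ha₂ ▸ hv))
  obtain ⟨t', rfl⟩ := exists_sliceEval_eq M a' (act_mem_thin_of_triangle ha' (by
    intro i
    fin_cases i
    · exact ha'₀ ▸ hv
    · exact ha'₁ ▸ hσ _
    · exact ha'₂ ▸ hw))
  have key : ∀ f : (A.slice ({∅} : Set (Set M))) _⦋1⦌,
      sliceEval ((A.slice ({∅} : Set (Set M))).σ 0 ((A.slice _).δ 1 f)) =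
        A.toSSet.σ 0 (A.toSSet.δ 1 (sliceEval f)) := fun f =>
    (sliceEval_act ⟨(0 : Fin 1).predAbove, _⟩ _).trans (congrArg _ (sliceEval_act _ f))
  exact ⟨g, t, t', isTriangle_of_sliceEval ⟨ha₂, ha₀, ha₁.trans (key f).symm⟩,
    isTriangle_of_sliceEval ⟨ha'₂, ha'₀, ha'₁.trans (key g).symm⟩⟩

end StratSet

/-! ### Outer extensions at the first vertex -/

namespace JoinPoset

variable {m : ℕ}

/-- The identification of the join of `Δ[1]` and `Δ[m]` with `Δ[m + 2]`. -/
def toFin (m : ℕ) : JoinPoset 1 (Fin (m + 1)) →o Fin (m + 2 + 1) where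
  toFun x := Sum.elim (fun i : Fin (1 + 1) => (⟨i, by omega⟩ : Fin (m + 2 + 1)))
    (fun j : Fin (m + 1) => ⟨j + 2, by omega⟩) (ofLex x)
  monotone' := by
    rintro (i | j) (i' | j') h
    · exact (Sum.Lex.inl_le_inl_iff.1 h : i ≤ i')
    · change (i : ℕ) ≤ j' + 2
      omega
    · exact (Sum.Lex.not_inr_le_inl h).elim
    · exact Nat.add_le_add_right (Sum.Lex.inr_le_inr_iff.1 h : j ≤ j') 2

@[simp]
lemma toFin_inlₗ (i : Fin (1 + 1)) : toFin m (Sum.inlₗ i) = ⟨i, by omega⟩ := rfl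

@[simp]
lemma toFin_inrₗ (j : Fin (m + 1)) : toFin m (Sum.inrₗ j) = ⟨j + 2, by omega⟩ := rfl

/-- The identification of `Δ[m + 2]` with the join of `Δ[1]` and `Δ[m]`. -/
def ofFin (m : ℕ) : Fin (m + 2 + 1) →o JoinPoset 1 (Fin (m + 1)) where
  toFun x := if h : (x : ℕ) < 2 then Sum.inlₗ ⟨x, h⟩ else Sum.inrₗ ⟨x - 2, by omega⟩
  monotone' x y hxy := by
    have hxy' : (x : ℕ) ≤ y := hxy
    dsimp only
    split_ifs with h h' h'
    · exact Sum.Lex.inl_le_inl_iff.2 hxy'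
    · exact Sum.Lex.inl_le_inr _ _
    · omega
    · exact Sum.Lex.inr_le_inr_iff.2 (Nat.sub_le_sub_right hxy' 2 : (x : ℕ) - 2 ≤ y - 2)

lemma ofFin_of_lt {x : Fin (m + 2 + 1)} (h : (x : ℕ) < 2) : ofFin m x = Sum.inlₗ ⟨x, h⟩ :=
  dif_pos h

lemma ofFin_of_not_lt {x : Fin (m + 2 + 1)} (h : ¬ (x : ℕ) < 2) :
    ofFin m x = Sum.inrₗ ⟨x - 2, by omega⟩ :=
  dif_neg h

lemma toFin_ofFin (x : Fin (m + 2 + 1)) : toFin m (ofFin m x) = x := by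
  by_cases h : (x : ℕ) < 2
  · rw [ofFin_of_lt h, toFin_inlₗ]
  · rw [ofFin_of_not_lt h, toFin_inrₗ, Fin.ext_iff]
    exact Nat.sub_add_cancel (not_lt.1 h)

lemma ofFin_toFin (x : JoinPoset 1 (Fin (m + 1))) : ofFin m (toFin m x) = x := by
  rcases x with i | j
  · exact ofFin_of_lt (x := toFin m (Sum.inlₗ i)) i.2
  · exact ofFin_of_not_lt (x := toFin m (Sum.inrₗ j)) (not_lt.2 (Nat.le_add_left 2 j))

lemma toFin_mem_range {s : ℕ} {β : Fin (s + 1) →o Fin (m + 2 + 1)}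
    {x : JoinPoset 1 (Fin (m + 1))} :
    x ∈ Set.range ((ofFin m).comp β) ↔ toFin m x ∈ Set.range β := by
  constructor
  · rintro ⟨i, rfl⟩
    exact ⟨i, (toFin_ofFin (β i)).symm⟩
  · rintro ⟨i, hi⟩
    exact ⟨i, by rw [OrderHom.comp_coe, Function.comp_apply, hi, ofFin_toFin]⟩

lemma range_comp_mem_nonconst {s : ℕ} {β : Fin (s + 1) →o Fin (m + 2 + 1)}
    (h₀ : (0 : Fin (m + 2 + 1)) ∈ Set.range β) (h₁ : (1 : Fin (m + 2 + 1)) ∈ Set.range β) :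
    Set.range ((ofFin m).comp β) ∈ nonconst 1 (Fin (m + 1)) :=
  ⟨0, 1, by decide, toFin_mem_range.2 h₀, toFin_mem_range.2 h₁⟩

lemma toFin_map_δ_one_ne (x : JoinPoset 0 (Fin (m + 1))) :
    toFin m (map (Fin (m + 1)) (1 : Fin 2).succAboveOrderEmb.toOrderHom x) ≠ 1 := by
  intro h
  have h' := congrArg Fin.val h
  rcases x with i | j
  · change ((1 : Fin 2).succAbove i : ℕ) = 1 at h'
    rw [show i = 0 from Fin.ext (by omega)] at h'
    revert h'
    decide
  · change (j : ℕ) + 2 = 1 at h'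
    omega

/-- The collapse of `Δ[1]` to a point. -/
def collapse : Fin (1 + 1) →o Fin (0 + 1) := ⟨fun _ => 0, fun _ _ _ => le_rfl⟩

end JoinPoset

namespace StratSet

open JoinPoset

variable {A : StratSet.{u}} {m : ℕ}

/-- A chain that misses the vertex `i` of `Δ[1]` uses at most the other one, so it is fixed by
collapsing `Δ[1]` to a point and including that point as the other vertex. -/
lemma sliceVal_eq_δ {M : Type} [LinearOrder M] {C : Set (Set M)} (y : (A.slice C) _⦋1⦌)
    (i : Fin 2) {s : ℕ} (α : Fin (s + 1) →o JoinPoset 1 M) (hα : Set.range α ∈ sieve 1 C)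
    (hi : Sum.inlₗ i ∉ Set.range α) :
    (sliceVal y).val s α hα =
      (sliceVal ((A.slice C).δ i y)).val s ((map M collapse).comp α)
        (range_map_comp_mem_sieve _ hα) := by
  have h : (map M (i.succAboveOrderEmb.toOrderHom.comp collapse)).comp α = α := by
    refine map_comp_eq_self fun j hj => ?_
    have : j ≠ i := by
      rintro rfl
      exact hi hj
    have key : ∀ i j : Fin 2, j ≠ i → i.succAbove 0 = j := by decide
    exact key i j this
  rw [map_comp] at h
  exact ((sliceVal y).val_congr h.symm hα).trans rfl

/-- Every thin `1`-simplex of `A` has an equivalence inverse. -/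
def HasInverses (A : StratSet.{u}) : Prop :=
  ∀ v : A.toSSet _⦋1⦌, v ∈ A.thin 1 → ∃ w : A.toSSet _⦋1⦌, A.AreEquivalenceInverses v w

lemma isLowerSet_singleton_empty (M : Type) : IsLowerSet ({∅} : Set (Set M)) := by
  rintro S T hTS rfl
  exact Set.subset_empty_iff.1 hTS

lemma isLowerSet_ne_univ (M : Type) : IsLowerSet ({S | S ≠ Set.univ} : Set (Set M)) :=
  fun _ _ hTS hS hT => hS (Set.univ_subset_iff.1 (hT ▸ hTS))

/-- The horn is an edge `y` of the slice over `∂Δ[m]`, from the faces opposite the vertices from `2`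
on, with a lift `x` of its source to the slice over `Δ[m]`, from the face opposite `1`. The edge
lies over the thin edge `01` of `A`, which is invertible, so it lifts with source `x`. -/
lemma IsWeakInnerComplicial.hasRLP_hornExtension_zero (hA : A.IsWeakInnerComplicial)
    (hinv : A.HasInverses) (m : ℕ) : HasRLP (hornExtension (m + 2) 0) A := by
  refine hasRLP_hornExtension_of fun f hf => ?_
  let M := Fin (m + 1)
  let C : Set (Set M) := {S | S ≠ Set.univ}
  let D : Set (Set M) := Set.univ
  have hf₁ : ∀ S ∈ sieve 1 C, ∃ j, j ≠ 0 ∧ j ∉ toFin m '' S := by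
    intro S hS
    obtain ⟨j, hj⟩ := (Set.ne_univ_iff_exists_notMem _).1 hS
    refine ⟨toFin m (Sum.inrₗ j), ?_, ?_⟩
    · rw [toFin_inrₗ, Ne, Fin.ext_iff]
      simp
    · rintro ⟨x, hx, hx'⟩
      refine hj ?_
      have : x = Sum.inrₗ j := by rw [← ofFin_toFin x, hx', ofFin_toFin]
      rw [this] at hx
      exact hx
  let y : (A.slice C) _⦋1⦌ := sliceMk (f.comap (toFin m) hf₁) (by
    rintro s α hα ⟨i, j, hij, ⟨i', hi⟩, ⟨j', hj⟩⟩
    -- For `k = 0` the marked simplices are those containing `0` and `1`, that is, those not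
    -- constant on `Δ[1]`; this is the thinness condition of the slice.
    have hall : ∀ l : Fin (1 + 1), Sum.inlₗ l ∈ Set.range α := by
      intro l
      have key : ∀ i j l : Fin 2, i ≠ j → l = i ∨ l = j := by decide
      have := key i j l hij
      obtain rfl | rfl := this
      · exact ⟨i', hi⟩
      · exact ⟨j', hj⟩
    refine hf _ _ _ fun l hl => ?_
    have hl2 : (l : ℕ) < 2 := by
      have h0 : ((0 : Fin (m + 2 + 1)) : ℕ) = 0 := rfl
      omega
    obtain ⟨x, hx⟩ := hall ⟨l, hl2⟩
    exact ⟨x, by rw [OrderHom.comp_coe, Function.comp_apply, hx]; rfl⟩)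
  let d₁ : Fin (0 + 1) →o Fin (1 + 1) := (1 : Fin 2).succAboveOrderEmb.toOrderHom
  let x : (A.slice D) _⦋0⦌ := sliceMk (f.comap ((toFin m).comp (map M d₁)) (by
    intro S _
    refine ⟨1, by simp, ?_⟩
    rintro ⟨z, -, hz⟩
    exact toFin_map_δ_one_ne z hz)) (by
    rintro s α hα ⟨i, j, hij, -⟩
    exact (hij (Fin.ext (by omega))).elim)
  have hCD : C ⊆ D := Set.subset_univ _
  have hD : IsLowerSet D := isLowerSet_univ
  have hC : IsLowerSet C := isLowerSet_ne_univ M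
  have hE : IsLowerSet ({∅} : Set (Set M)) := isLowerSet_singleton_empty M
  have hEC : ({∅} : Set (Set M)) ⊆ C := by
    rintro S rfl
    exact Set.empty_ne_univ
  obtain ⟨w, hw⟩ := hinv _ (sliceEval_mem_thin ((sliceRes hEC).app _ y))
  obtain ⟨g, t, t', ht, ht'⟩ := hw.exists_slice M
  obtain ⟨y', hy', hy'x⟩ := SSet.HornLift.exists_lift_source
    (hA.hornLift_sliceRes hC hD hCD (r := 1) 1 (by decide) (Or.inr Set.empty_ne_univ))
    (hA.hornLift_sliceRes hC hD hCD (r := 2) 2 (by decide) (Or.inr Set.empty_ne_univ))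
    (hA.hornLift_sliceRes hE hC hEC (r := 2) 2 (by decide) (Or.inr rfl))
    (hA.hornFill_slice hC (r := 3) 1 (by decide) (by decide))
    (hA.hornFill_slice hC (r := 3) 2 (by decide) (by decide))
    y ht ht' x (slice_ext fun s α hα => rfl)
  have hmem : ∀ {s : ℕ} (α : Fin (s + 1) →o JoinPoset 1 M), Set.range α ∈ sieve 1 D :=
    fun _ => Set.mem_univ _
  have hval : ∀ (r : ℕ) (β : Fin (r + 1) →o Fin (m + 2 + 1)),
      A.toSSet.act β ((sliceVal y').val _ (ofFin m) (hmem _)) =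
        (sliceVal y').val _ ((ofFin m).comp β) (hmem _) :=
    fun r β => ((sliceVal y').val_comp _ _ _ _).symm
  refine ⟨(sliceVal y').val _ (ofFin m) (hmem _), fun r β h => ?_, fun r β _ hβ => ?_⟩
  · rw [hval]
    obtain ⟨j, hj0, hj⟩ := h
    -- A chain missing `1` is read off from the source `x` of `y'`, and one missing a later vertex
    -- from its restriction `y`.
    by_cases hj2 : (j : ℕ) < 2
    · have hj1 : j = toFin m (Sum.inlₗ 1) := by
        rw [toFin_inlₗ, Fin.ext_iff]
        have : (j : ℕ) ≠ 0 := fun h => hj0 (Fin.ext h)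
        change (j : ℕ) = 1
        omega
      have hj' : (Sum.inlₗ 1 : JoinPoset 1 M) ∉ Set.range ((ofFin m).comp β) := by
        rw [toFin_mem_range, ← hj1]
        exact hj
      rw [sliceVal_eq_δ y' 1 _ _ hj', hy'x]
      refine f.val_congr ?_ _
      ext i : 2
      have h1 : (map M (d₁.comp collapse)).comp ((ofFin m).comp β) = (ofFin m).comp β := by
        refine map_comp_eq_self fun l hl => ?_
        have : l ≠ 1 := by
          rintro rfl
          exact hj' hl
        have key : ∀ l : Fin 2, l ≠ 1 → (1 : Fin 2).succAbove 0 = l := by decide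
        exact key l this
      rw [map_comp] at h1
      have h2 := congrArg (toFin m) (DFunLike.congr_fun h1 i)
      exact h2.trans (toFin_ofFin (β i))
    · have hmemC : Set.range ((ofFin m).comp β) ∈ sieve 1 C := by
        refine (Set.ne_univ_iff_exists_notMem _).2 ⟨⟨j - 2, by omega⟩, fun h => hj ?_⟩
        have h := toFin_mem_range.1 h
        rw [toFin_inrₗ] at h
        convert h
        simp only
        omega
      have h1 := sliceVal_sliceRes hCD y' _ hmemC
      rw [hy'] at h1
      rw [← h1]
      refine f.val_congr ?_ _
      ext i : 2
      exact toFin_ofFin (β i)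
  · rw [hval]
    exact isStrat_sliceVal y' _ _ _ (range_comp_mem_nonconst (hβ 0 (by simp)) (hβ 1 (by simp)))

/-- Regard the simplex as an edge `y` of the slice over `Δ[m]` and lift an inverse of its underlying
edge to an edge `g` running backwards. As a simplex of `A`, `g` has the face of `x` opposite `1` as
its face opposite `0`, and the face of `x` opposite `0` as its face opposite `1`. The first is thin
by assumption, the faces that contain `0` and `1` are thin by the slice condition, and the inner
extension at `1` makes the second thin. -/
lemma IsWeakInnerComplicial.hasRLP_thinnessExtension_zero (hA : A.IsWeakInnerComplicial)
    (hinv : A.HasInverses) (m : ℕ) : HasRLP (thinnessExtension (m + 2) 0) A := by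
  refine hasRLP_thinnessExtension_of (by omega) fun x hx hx' r β hr hβ hβ0 => ?_
  let M := Fin (m + 1)
  let D : Set (Set M) := Set.univ
  have hD : IsLowerSet D := isLowerSet_univ
  have hE : IsLowerSet ({∅} : Set (Set M)) := isLowerSet_singleton_empty M
  have hED : ({∅} : Set (Set M)) ⊆ D := Set.subset_univ _
  let y : (A.slice D) _⦋1⦌ := sliceMk
    ⟨fun s α _ => A.toSSet.act ((toFin m).comp α) x, fun α β _ _ => by rw [SSet.act_act]; rfl⟩ (by
    rintro s α hα ⟨i, j, hij, ⟨i', hi⟩, ⟨j', hj⟩⟩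
    have hall : ∀ l : Fin (1 + 1), Sum.inlₗ l ∈ Set.range α := by
      intro l
      have key : ∀ i j l : Fin 2, i ≠ j → l = i ∨ l = j := by decide
      have := key i j l hij
      obtain rfl | rfl := this
      · exact ⟨i', hi⟩
      · exact ⟨j', hj⟩
    have hs : 0 < s := by
      by_contra hs
      obtain rfl : s = 0 := by omega
      rw [show i' = j' from Fin.ext (by omega), hj] at hi
      exact hij (Sum.inl_injective hi).symm
    refine hx _ _ hs fun l hl => ?_
    have hl2 : (l : ℕ) < 2 := by
      have h0 : ((0 : Fin (m + 2 + 1)) : ℕ) = 0 := rfl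
      omega
    obtain ⟨x, hx⟩ := hall ⟨l, hl2⟩
    exact ⟨x, by rw [OrderHom.comp_coe, Function.comp_apply, hx]; rfl⟩)
  obtain ⟨w, hw⟩ := hinv _ (sliceEval_mem_thin ((sliceRes hED).app _ y))
  obtain ⟨w', t, t', -, ht'⟩ := hw.exists_slice M
  obtain ⟨g, z, hz, -⟩ := (hA.hornLift_sliceRes hE hD hED (r := 2) 2 (by decide)
    (Or.inr rfl)).exists_isTriangle y ht'
  have hg₀ : (A.slice D).δ 0 g = (A.slice D).δ 1 y := hz.δ_eq.2.1
  have hg₁ : (A.slice D).δ 1 g = (A.slice D).δ 0 y :=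
    hz.δ_eq.1.trans ((A.slice D).δ_comp_σ_succ_apply 0 _)
  have hmem : ∀ {s : ℕ} (α : Fin (s + 1) →o JoinPoset 1 M), Set.range α ∈ sieve 1 D :=
    fun _ => Set.mem_univ _
  have hgval : ∀ (r : ℕ) (β : Fin (r + 1) →o Fin (m + 2 + 1)),
      A.toSSet.act β ((sliceVal g).val _ (ofFin m) (hmem _)) =
        (sliceVal g).val _ ((ofFin m).comp β) (hmem _) :=
    fun r β => ((sliceVal g).val_comp _ _ _ _).symm
  have hyval : ∀ (r : ℕ) (β : Fin (r + 1) →o Fin (m + 2 + 1)),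
      A.toSSet.act β x = (sliceVal y).val _ ((ofFin m).comp β) (hmem _) := by
    intro r β
    change _ = A.toSSet.act _ x
    congr 1
    ext i : 2
    exact (toFin_ofFin (β i)).symm
  have hgthin := act_mem_thin_of_thinnessExtension (r := r)
    (hA.thinness (m + 2) 1 (by omega) (by simp) (by simp)) ((sliceVal g).val _ (ofFin m) (hmem _))
    (by
      intro r β _ hβ
      rw [hgval]
      exact isStrat_sliceVal g _ _ _ (range_comp_mem_nonconst (hβ 0 (by simp)) (hβ 1 (by simp))))
    (by
      rintro r β hr0 hr hβ ⟨j, hj1, hj⟩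
      rw [hgval]
      by_cases hj0 : j = 0
      · subst hj0
        rw [sliceVal_eq_δ g 0 _ _ (fun h => hj (toFin_mem_range.1 h)), hg₀]
        refine hx' _ _ hr ⟨1, by simp, ?_⟩
        rintro ⟨i, hi⟩
        exact toFin_map_δ_one_ne _ hi
      · have hrange := Fin.range_eq_compl_of_injective hr hβ hj
        refine isStrat_sliceVal g _ _ _ (range_comp_mem_nonconst ?_ ?_)
        · rw [hrange]
          exact Ne.symm hj0
        · rw [hrange]
          exact Ne.symm hj1)
  -- The face of `x` opposite `0` is the target of `y`, which is the source of `g`.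
  rw [hyval, sliceVal_eq_δ y 0 _ _ (fun h => hβ0 (toFin_mem_range.1 h)), ← hg₁]
  have h1 := hgthin (by omega) hr
    ((toFin m).comp ((map M (1 : Fin 2).succAboveOrderEmb.toOrderHom).comp
      ((map M collapse).comp ((ofFin m).comp β))))
  rw [hgval] at h1
  convert h1 using 1
  refine (sliceVal g).val_congr ?_ _
  ext i : 2
  exact (ofFin_toFin _).symm

end StratSet

/-! ### Duality by reversal of the vertices -/

/-- The conjugate of a monotone map by the reversal of the vertices. -/
def OrderHom.revConj {a b : ℕ} (f : Fin (a + 1) →o Fin (b + 1)) : Fin (a + 1) →o Fin (b + 1) :=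
  ⟨fun i => (f i.rev).rev, fun _ _ h => Fin.rev_le_rev.2 (f.monotone (Fin.rev_le_rev.2 h))⟩

namespace OrderHom

variable {a b c : ℕ}

lemma revConj_apply (f : Fin (a + 1) →o Fin (b + 1)) (i : Fin (a + 1)) :
    f.revConj i = (f i.rev).rev := rfl

@[simp]
lemma revConj_revConj (f : Fin (a + 1) →o Fin (b + 1)) : f.revConj.revConj = f := by
  ext i : 2
  simp [revConj_apply]

lemma revConj_comp (f : Fin (b + 1) →o Fin (c + 1)) (g : Fin (a + 1) →o Fin (b + 1)) :
    (f.comp g).revConj = f.revConj.comp g.revConj := by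
  ext i : 2
  simp [revConj_apply]

lemma mem_range_revConj {f : Fin (a + 1) →o Fin (b + 1)} {i : Fin (b + 1)} :
    i ∈ Set.range f.revConj ↔ i.rev ∈ Set.range f := by
  constructor
  · rintro ⟨j, rfl⟩
    exact ⟨j.rev, by simp [revConj_apply]⟩
  · rintro ⟨j, hj⟩
    exact ⟨j.rev, by simp [revConj_apply, hj]⟩

end OrderHom

namespace StratSet

/-- An identification of the simplices of `B` with those of `A` which reverses their vertices. -/
structure ReversalEquiv (A B : StratSet.{u}) where
  /-- the bijection on simplices -/
  equiv (n : ℕ) : A.toSSet _⦋n⦌ ≃ B.toSSet _⦋n⦌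
  equiv_act {a b : ℕ} (f : Fin (a + 1) →o Fin (b + 1)) (x : A.toSSet _⦋b⦌) :
    equiv a (A.toSSet.act f x) = B.toSSet.act f.revConj (equiv b x)
  equiv_mem_thin {n : ℕ} (x : A.toSSet _⦋n⦌) : equiv n x ∈ B.thin n ↔ x ∈ A.thin n

namespace ReversalEquiv

variable {A B : StratSet.{u}} (e : ReversalEquiv A B)

/-- The inverse identification. -/
def symm : ReversalEquiv B A where
  equiv n := (e.equiv n).symm
  equiv_act f x := by
    rw [Equiv.symm_apply_eq, e.equiv_act, OrderHom.revConj_revConj, Equiv.apply_symm_apply]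
  equiv_mem_thin x := by rw [← e.equiv_mem_thin, Equiv.apply_symm_apply]

lemma symm_act {a b : ℕ} (f : Fin (a + 1) →o Fin (b + 1)) (y : B.toSSet _⦋b⦌) :
    A.toSSet.act f ((e.equiv b).symm y) = (e.equiv a).symm (B.toSSet.act f.revConj y) := by
  rw [Equiv.eq_symm_apply, e.equiv_act, Equiv.apply_symm_apply]

lemma act_mem_thin {a b : ℕ} (f : Fin (a + 1) →o Fin (b + 1)) (y : B.toSSet _⦋b⦌) :
    B.toSSet.act f y ∈ B.thin a ↔
      A.toSSet.act f.revConj ((e.equiv b).symm y) ∈ A.thin a := by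
  rw [symm_act, OrderHom.revConj_revConj, ← e.equiv_mem_thin, Equiv.apply_symm_apply]

include e

lemma hasRLP_hornExtension {n : ℕ} {k : Fin (n + 1)} (h : HasRLP (hornExtension n k) A) :
    HasRLP (hornExtension n k.rev) B := by
  refine hasRLP_hornExtension_of fun f hf => ?_
  have hK : ∀ {s : ℕ} (α : Fin (s + 1) →o Fin (n + 1)), (∃ j, j ≠ k ∧ j ∉ Set.range α) →
      ∃ j, j ≠ k.rev ∧ j ∉ Set.range α.revConj := by
    rintro s α ⟨j, hj, hj'⟩
    refine ⟨j.rev, Fin.rev_injective.ne hj, ?_⟩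
    rwa [OrderHom.mem_range_revConj, Fin.rev_rev]
  have hK' : ∀ {s : ℕ} (α : Fin (s + 1) →o Fin (n + 1)), (∃ j, j ≠ k.rev ∧ j ∉ Set.range α) →
      ∃ j, j ≠ k ∧ j ∉ Set.range α.revConj := by
    rintro s α ⟨j, hj, hj'⟩
    refine ⟨j.rev, fun h => hj (by rw [← h, Fin.rev_rev]), ?_⟩
    rwa [OrderHom.mem_range_revConj, Fin.rev_rev]
  obtain ⟨x, hx, hx'⟩ := hornFiller h
    { val s α hα := (e.equiv s).symm (f.val s α.revConj (hK α hα))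
      val_comp {s t} α β h h' := by
        rw [e.symm_act, ← f.val_comp _ _ _ (OrderHom.revConj_comp α β ▸ hK _ h')]
        exact congrArg _ (f.val_congr (OrderHom.revConj_comp α β) _) }
    (by
      intro s α hα hαk
      change (e.equiv s).symm _ ∈ A.thin s
      rw [← e.equiv_mem_thin, Equiv.apply_symm_apply]
      refine hf _ _ _ fun i hi => ?_
      rw [OrderHom.mem_range_revConj]
      refine hαk _ ?_
      rw [Fin.val_rev] at hi ⊢
      omega)
  refine ⟨e.equiv n x, fun r β hβ => ?_, fun r β hr hβ => ?_⟩
  · have key := e.equiv_act β.revConj x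
    rw [OrderHom.revConj_revConj, hx _ _ (hK' β hβ)] at key
    refine key.symm.trans (((e.equiv r).apply_symm_apply _).trans (f.val_congr ?_ _))
    exact OrderHom.revConj_revConj β
  · rw [e.act_mem_thin, Equiv.symm_apply_apply]
    refine hx' r _ hr fun i hi => ?_
    rw [OrderHom.mem_range_revConj]
    refine hβ _ ?_
    rw [Fin.val_rev, Fin.val_rev]
    omega

lemma hasRLP_thinnessExtension {n : ℕ} (hn : 2 ≤ n) {k : Fin (n + 1)}
    (h : HasRLP (thinnessExtension n k) A) : HasRLP (thinnessExtension n k.rev) B := by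
  refine hasRLP_thinnessExtension_of hn fun x hx hx' r β hr _ _ => ?_
  rw [e.act_mem_thin]
  refine act_mem_thin_of_thinnessExtension h _ (fun r β hr hβ => ?_) (fun r β _ hr hβ hj => ?_)
    (by omega) hr _
  · rw [← OrderHom.revConj_revConj β, ← e.act_mem_thin]
    refine hx r _ hr fun i hi => ?_
    rw [OrderHom.mem_range_revConj]
    refine hβ _ ?_
    rw [Fin.val_rev] at hi ⊢
    omega
  · rw [← OrderHom.revConj_revConj β, ← e.act_mem_thin]
    refine hx' r _ hr ?_
    obtain ⟨j, hj, hj'⟩ := hj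
    refine ⟨j.rev, Fin.rev_injective.ne hj, ?_⟩
    rwa [OrderHom.mem_range_revConj, Fin.rev_rev]

lemma isWeakInnerComplicial (hA : A.IsWeakInnerComplicial) : B.IsWeakInnerComplicial where
  horn n k hn hk0 hkn := by
    have := e.hasRLP_hornExtension (hA.horn n k.rev hn (by rw [Fin.val_rev]; omega)
      (by rw [Fin.val_rev]; omega))
    rwa [Fin.rev_rev] at this
  thinness n k hn hk0 hkn := by
    have := e.hasRLP_thinnessExtension hn (hA.thinness n k.rev hn (by rw [Fin.val_rev]; omega)
      (by rw [Fin.val_rev]; omega))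
    rwa [Fin.rev_rev] at this

lemma equiv_δ {n : ℕ} (i : Fin (n + 2)) (x : A.toSSet _⦋n + 1⦌) :
    e.equiv n (A.toSSet.δ i x) = B.toSSet.δ i.rev (e.equiv (n + 1) x) := by
  rw [SSet.δ_eq_act, SSet.δ_eq_act, e.equiv_act]
  congr 1
  ext j : 2
  exact (Fin.succAbove_rev_left i j).symm

lemma equiv_σ_zero (x : A.toSSet _⦋0⦌) :
    e.equiv 1 (A.toSSet.σ 0 x) = B.toSSet.σ 0 (e.equiv 0 x) := by
  rw [SSet.σ_eq_act, SSet.σ_eq_act, e.equiv_act]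
  congr 1
  ext j : 2
  exact Fin.ext (by omega)

/-- Reversal exchanges the outer faces of a triangle, so the two witnessing triangles swap roles.
Their degenerate edges match because the target of each edge is the source of the other. -/
lemma hasInverses (hA : A.HasInverses) : B.HasInverses := by
  intro v hv
  obtain ⟨v, rfl⟩ := (e.equiv 1).surjective v
  rw [e.equiv_mem_thin] at hv
  obtain ⟨w, -, hw, ⟨a, ha, ha₂, ha₀, ha₁⟩, ⟨a', ha', ha'₂, ha'₀, ha'₁⟩⟩ := hA v hv
  refine ⟨e.equiv 1 w, (e.equiv_mem_thin v).2 hv, (e.equiv_mem_thin w).2 hw,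
    ⟨e.equiv 2 a', (e.equiv_mem_thin a').2 ha', ?_, ?_, ?_⟩,
    ⟨e.equiv 2 a, (e.equiv_mem_thin a).2 ha, ?_, ?_, ?_⟩⟩
  · rw [← ha'₀, e.equiv_δ]; rfl
  · rw [← ha'₂, e.equiv_δ]; rfl
  · have h : A.toSSet.δ 0 v = A.toSSet.δ 1 w :=
      (SSet.IsTriangle.δ_eq ⟨ha'₂, ha'₀, ha'₁⟩).2.2.trans (A.toSSet.δ_comp_σ_self_apply 0 _)
    refine (e.equiv_δ 1 a').symm.trans ?_
    rw [ha'₁, e.equiv_σ_zero, ← h, e.equiv_δ]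
    rfl
  · rw [← ha₀, e.equiv_δ]; rfl
  · rw [← ha₂, e.equiv_δ]; rfl
  · have h : A.toSSet.δ 0 w = A.toSSet.δ 1 v :=
      (SSet.IsTriangle.δ_eq ⟨ha₂, ha₀, ha₁⟩).2.2.trans (A.toSSet.δ_comp_σ_self_apply 0 _)
    refine (e.equiv_δ 1 a).symm.trans ?_
    rw [ha₁, e.equiv_σ_zero, ← h, e.equiv_δ]
    rfl

end ReversalEquiv

/-- The opposite stratified set, with the same simplices with reversed vertices. -/
protected def op (A : StratSet.{u}) : StratSet.{u} where
  toSSet := A.toSSet.op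
  thin n := {x | SSet.opObjEquiv x ∈ A.thin n}
  notMem_thin_zero _ := A.notMem_thin_zero _
  degenerate_subset_thin n x hx :=
    A.degenerate_subset_thin n ((SSet.opObjEquiv_mem_degenerate_iff _ x).2 hx)

/-- The identification of the simplices of a stratified set with those of its opposite. -/
def reversalEquivOp (A : StratSet.{u}) : ReversalEquiv A A.op where
  equiv n := SSet.opObjEquiv.symm
  equiv_act f x := by
    change A.toSSet.act f x = A.toSSet.act f.revConj.revConj x
    rw [OrderHom.revConj_revConj]
  equiv_mem_thin _ := Iff.rfl

end StratSet

/-! ### Weak complicial sets and invertibility of thin edges -/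

namespace StratSet

variable {A : StratSet.{u}}

lemma exists_ne_of_injective {s b : ℕ} (hs : 0 < s) {β : Fin (s + 1) → Fin (b + 1)}
    (hβ : Function.Injective β) : ∃ i j, β i ≠ β j :=
  ⟨0, Fin.last s, hβ.ne (Fin.ne_of_lt hs)⟩

lemma act_mem_thin_of_edge_of_pos {f : A.toSSet _⦋1⦌} (hf : f ∈ A.thin 1) {s : ℕ} (hs : 0 < s)
    (β : Fin (s + 1) →o Fin (1 + 1)) : A.toSSet.act β f ∈ A.thin s := by
  by_cases hβ : Function.Injective β
  · exact act_mem_thin_of_edge hf s β (exists_ne_of_injective hs hβ)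
  · exact act_mem_thin β hβ f

lemma act_mem_thin_of_triangle_of_pos {t : A.toSSet _⦋2⦌} (ht : t ∈ A.thin 2)
    (ht' : ∀ i, A.toSSet.δ i t ∈ A.thin 1) {s : ℕ} (hs : 0 < s)
    (β : Fin (s + 1) →o Fin (2 + 1)) : A.toSSet.act β t ∈ A.thin s := by
  by_cases hβ : Function.Injective β
  · exact act_mem_thin_of_triangle ht ht' s β (exists_ne_of_injective hs hβ)
  · exact act_mem_thin β hβ t

/-- The horn is a single point, and the degenerate edge on it is a filler. -/
lemma hasRLP_hornExtension_one (A : StratSet.{u}) (k : Fin (1 + 1)) :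
    HasRLP (hornExtension 1 k) A := by
  refine hasRLP_hornExtension_of fun f _ => ?_
  let c : Fin (0 + 1) →o Fin (1 + 1) := ⟨fun _ => k, fun _ _ _ => le_rfl⟩
  let d : Fin (1 + 1) →o Fin (0 + 1) := ⟨fun _ => 0, fun _ _ _ => le_rfl⟩
  have key : ∀ i j k : Fin 2, j ≠ k → i ≠ j → k = i := by decide
  have hk : ∀ k : Fin 2, k.rev ≠ k := by decide
  have hc : ∃ j, j ≠ k ∧ j ∉ Set.range c := ⟨k.rev, hk k, fun ⟨_, h⟩ => hk k h.symm⟩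
  refine ⟨A.toSSet.act d (f.val 0 c hc), fun r β h => ?_, fun r β hr _ => ?_⟩
  · obtain ⟨j, hj, hj'⟩ := id h
    have hβ : c.comp (d.comp β) = β := by
      ext i : 2
      exact key _ _ _ hj fun h => hj' ⟨i, h⟩
    rw [SSet.act_act, ← f.val_comp c (d.comp β) hc (by rw [hβ]; exact h)]
    exact f.val_congr hβ _
  · rw [SSet.act_act]
    refine act_mem_thin _ (fun hinj => hr.ne' ?_) _
    exact congrArg Fin.val (hinj (Fin.ext (by omega)) : Fin.last r = 0)

lemma IsWeakInnerComplicial.isWeakComplicial (hA : A.IsWeakInnerComplicial)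
    (hinv : A.HasInverses) : A.IsWeakComplicial where
  horn n k hn := by
    obtain ⟨m, rfl⟩ | rfl : (∃ m, n = m + 2) ∨ n = 1 := by
      obtain rfl | hn := hn.eq_or_lt
      · exact Or.inr rfl
      · exact Or.inl ⟨n - 2, by omega⟩
    · by_cases hk0 : k = 0
      · rw [hk0]
        exact hA.hasRLP_hornExtension_zero hinv m
      -- The last vertex of `A` is the first vertex of the opposite, which inherits both hypotheses.
      · by_cases hk : k = Fin.rev 0
        · rw [hk]
          exact A.reversalEquivOp.symm.hasRLP_hornExtension
            ((A.reversalEquivOp.isWeakInnerComplicial hA).hasRLP_hornExtension_zero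
              (A.reversalEquivOp.hasInverses hinv) m)
        · rw [Fin.ext_iff] at hk0 hk
          rw [Fin.val_rev] at hk
          simp only [Fin.coe_ofNat_eq_mod, Nat.zero_mod] at hk0 hk
          exact hA.horn _ k (by omega) (by omega) (by omega)
    · exact hasRLP_hornExtension_one A k
  thinness n k hn := by
    obtain ⟨m, rfl⟩ : ∃ m, n = m + 2 := ⟨n - 2, by omega⟩
    by_cases hk0 : k = 0
    · rw [hk0]
      exact hA.hasRLP_thinnessExtension_zero hinv m
    · by_cases hk : k = Fin.rev 0
      · rw [hk]
        exact A.reversalEquivOp.symm.hasRLP_thinnessExtension hn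
          ((A.reversalEquivOp.isWeakInnerComplicial hA).hasRLP_thinnessExtension_zero
            (A.reversalEquivOp.hasInverses hinv) m)
      · rw [Fin.ext_iff] at hk0 hk
        rw [Fin.val_rev] at hk
        simp only [Fin.coe_ofNat_eq_mod, Nat.zero_mod] at hk0 hk
        exact hA.thinness _ k hn (by omega) (by omega)

/-- Fill the horn `Λ⁰[2]` with `v` on `01` and a degenerate edge on `02`. The filler is thin as it
contains `0` and `1`, and its third edge is thin by the thinness extension since the other two are.
-/
lemma exists_right_inverse (h : HasRLP (hornExtension 2 0) A)
    (h' : HasRLP (thinnessExtension 2 0) A) {v : A.toSSet _⦋1⦌} (hv : v ∈ A.thin 1) :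
    ∃ w ∈ A.thin 1, ∃ a ∈ A.thin 2,
      SSet.IsTriangle a v w (A.toSSet.σ 0 (A.toSSet.δ 1 v)) := by
  -- `γ` is used only on chains that avoid `2`, so its value there is immaterial. `γ'` gives the
  -- degenerate edge at the source of `v`.
  let γ : Fin (2 + 1) →o Fin (1 + 1) := ⟨![0, 1, 1], by decide⟩
  let γ' : Fin (2 + 1) →o Fin (1 + 1) := ⟨fun _ => 0, fun _ _ _ => le_rfl⟩
  obtain ⟨f, hf₁, hf₂⟩ := PartialMap.exists_glue₂
    (P := Fin (2 + 1)) (K := {S | 2 ∉ S}) (L := {S | 1 ∉ S})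
    (fun S T hST hS hT => hS (hST hT)) (fun S T hST hS hT => hS (hST hT))
    ⟨fun s α _ => A.toSSet.act (γ.comp α) v, fun α β _ _ => (SSet.act_act β (γ.comp α) v).symm⟩
    ⟨fun s α _ => A.toSSet.act (γ'.comp α) v, fun α β _ _ => (SSet.act_act β (γ'.comp α) v).symm⟩
    (by
      intro s α hα hα'
      have key : ∀ i : Fin 3, i ≠ 2 → i ≠ 1 → γ i = γ' i := by decide
      refine congrArg (fun g => A.toSSet.act g v) ?_
      ext i : 2
      exact key _ (fun h => hα ⟨i, h⟩) fun h => hα' ⟨i, h⟩)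
  have hK : ({S | ∃ j, j ≠ 0 ∧ j ∉ S} : Set (Set (Fin (2 + 1)))) ⊆
      {S | 2 ∉ S} ∪ {S | 1 ∉ S} := by
    rintro S ⟨j, hj, hj'⟩
    have key : ∀ j : Fin 3, j ≠ 0 → j = 2 ∨ j = 1 := by decide
    obtain rfl | rfl := key j hj
    · exact Or.inl hj'
    · exact Or.inr hj'
  have hf : ∀ {s : ℕ} (hs : 0 < s) (α : Fin (s + 1) →o Fin (2 + 1)) hα,
      f.val s α hα ∈ A.thin s := by
    rintro s hs α (hα | hα)
    · rw [hf₁ s α hα]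
      exact act_mem_thin_of_edge_of_pos hv hs _
    · rw [hf₂ s α hα]
      exact act_mem_thin_of_edge_of_pos hv hs _
  obtain ⟨a, ha, ha'⟩ := hornFiller h (f.res hK) (by
    intro s α hα hα'
    refine hf (Nat.pos_of_ne_zero ?_) _ _
    rintro rfl
    obtain ⟨i, hi⟩ := hα' 0 (by decide)
    obtain ⟨j, hj⟩ := hα' 1 (by decide)
    rw [show i = j from Fin.ext (by omega), hj] at hi
    revert hi
    decide)
  refine ⟨A.toSSet.δ 0 a, ?_, a, ?_, ?_, rfl, ?_⟩
  · refine act_mem_thin_of_thinnessExtension h' a ha' (fun r β hr _ _ hβ => ?_) one_pos rfl _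
    rw [ha r β hβ]
    exact hf hr _ _
  · rw [← A.toSSet.act_id a]
    exact ha' 2 OrderHom.id (by omega) fun i _ => ⟨i, rfl⟩
  · have h2 : (2 : Fin (2 + 1)) ∉ Set.range (2 : Fin 3).succAboveOrderEmb.toOrderHom := by
      rintro ⟨i, hi⟩
      exact Fin.succAbove_ne _ _ hi
    refine (ha _ _ ⟨2, by decide, h2⟩).trans ((hf₁ _ _ h2).trans ?_)
    refine (congrArg (fun g => A.toSSet.act g v) ?_).trans (A.toSSet.act_id v)
    ext i : 2
    revert i
    decide
  · have h1 : (1 : Fin (2 + 1)) ∉ Set.range (1 : Fin 3).succAboveOrderEmb.toOrderHom := by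
      rintro ⟨i, hi⟩
      exact Fin.succAbove_ne _ _ hi
    refine (ha _ _ ⟨1, by decide, h1⟩).trans ((hf₂ _ _ h1).trans ?_)
    rw [SSet.σ_eq_act, SSet.δ_eq_act, SSet.act_act]
    refine congrArg (fun g => A.toSSet.act g v) ?_
    ext i : 2
    revert i
    decide

lemma IsWeakComplicial.isWeakInnerComplicial (hA : A.IsWeakComplicial) :
    A.IsWeakInnerComplicial where
  horn n k hn _ _ := hA.horn n k hn
  thinness n k hn _ _ := hA.thinness n k hn

lemma IsWeakComplicial.exists_left_inverse (hA : A.IsWeakComplicial) {v : A.toSSet _⦋1⦌}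
    (hv : v ∈ A.thin 1) :
    ∃ w ∈ A.thin 1, ∃ a ∈ A.thin 2,
      SSet.IsTriangle a w v (A.toSSet.σ 0 (A.toSSet.δ 0 v)) := by
  let e := A.reversalEquivOp
  have h := e.hasRLP_hornExtension (hA.horn 2 2 (by omega))
  have h' := e.hasRLP_thinnessExtension le_rfl (hA.thinness 2 2 le_rfl)
  obtain ⟨w, hw, a, ha, ha₂, ha₀, ha₁⟩ := exists_right_inverse (A := A.op) h h'
    ((e.equiv_mem_thin v).2 hv)
  refine ⟨e.symm.equiv 1 w, (e.symm.equiv_mem_thin w).2 hw, e.symm.equiv 2 a,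
    (e.symm.equiv_mem_thin a).2 ha, ?_, ?_, ?_⟩
  · rw [← ha₀, e.symm.equiv_δ]
    rfl
  · refine (e.symm.equiv_δ 2 a).symm.trans ?_
    rw [ha₂]
    exact (e.equiv 1).symm_apply_apply v
  · refine (e.symm.equiv_δ 1 a).symm.trans ?_
    rw [ha₁, e.symm.equiv_σ_zero, e.symm.equiv_δ]
    exact congrArg (fun x => A.toSSet.σ 0 (A.toSSet.δ 0 x)) ((e.equiv 1).symm_apply_apply v)

lemma exists_slice_triangle {M : Type} [LinearOrder M]
    {f g h : (A.slice ({∅} : Set (Set M))) _⦋1⦌} {a : A.toSSet _⦋2⦌} (ha : a ∈ A.thin 2)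
    (ht : SSet.IsTriangle a (sliceEval f) (sliceEval g) (sliceEval h)) :
    ∃ t, SSet.IsTriangle t f g h := by
  obtain ⟨t, rfl⟩ := exists_sliceEval_eq M a (act_mem_thin_of_triangle ha (by
    intro i
    fin_cases i
    · exact ht.2.1 ▸ sliceEval_mem_thin g
    · exact ht.2.2 ▸ sliceEval_mem_thin h
    · exact ht.1 ▸ sliceEval_mem_thin f))
  exact ⟨t, isTriangle_of_sliceEval ht⟩

lemma sliceEval_σ_δ {M : Type} [LinearOrder M] (i : Fin 2)
    (f : (A.slice ({∅} : Set (Set M))) _⦋1⦌) :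
    sliceEval ((A.slice ({∅} : Set (Set M))).σ 0 ((A.slice _).δ i f)) =
      A.toSSet.σ 0 (A.toSSet.δ i (sliceEval f)) :=
  (sliceEval_act ⟨(0 : Fin 1).predAbove, _⟩ _).trans (congrArg _ (sliceEval_act _ f))

/-- The outer extensions give a right inverse `w` and a left inverse `u`. Comparing them turns `w`
into a two-sided inverse. The comparison is made in the slice over `{∅}`, where inner horns need no
thinness condition and the triangle obtained is automatically thin. -/
lemma IsWeakComplicial.hasInverses (hA : A.IsWeakComplicial) : A.HasInverses := by
  intro v hv
  obtain ⟨w, hw, a, ha, hat⟩ := exists_right_inverse (hA.horn 2 0 (by omega))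
    (hA.thinness 2 0 le_rfl) hv
  obtain ⟨u, hu, b, hb, hbt⟩ := hA.exists_left_inverse hv
  refine ⟨w, hv, hw, ⟨a, ha, hat⟩, ?_⟩
  have hC : IsLowerSet ({∅} : Set (Set (Fin 0))) := isLowerSet_singleton_empty _
  obtain ⟨v, rfl⟩ := exists_sliceEval_eq (Fin 0) v (act_mem_thin_of_edge hv)
  obtain ⟨w, rfl⟩ := exists_sliceEval_eq (Fin 0) w (act_mem_thin_of_edge hw)
  obtain ⟨u, rfl⟩ := exists_sliceEval_eq (Fin 0) u (act_mem_thin_of_edge hu)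
  have hwv : (A.slice ({∅} : Set (Set (Fin 0)))).δ 0 w = (A.slice _).δ 1 v :=
    sliceEval_injective ((sliceEval_act _ w).trans ((hat.δ_eq.2.2.trans
      (A.toSSet.δ_comp_σ_self_apply 0 _)).trans (sliceEval_act _ v).symm))
  obtain ⟨z₁, hz₁⟩ := exists_slice_triangle (f := v) (g := w)
    (h := (A.slice ({∅} : Set (Set (Fin 0)))).σ 0 ((A.slice _).δ 0 w)) ha (by
      rw [hwv, sliceEval_σ_δ]
      exact hat)
  obtain ⟨z₂, hz₂⟩ := exists_slice_triangle (f := u) (g := v)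
    (h := (A.slice ({∅} : Set (Set (Fin 0)))).σ 0 ((A.slice _).δ 0 v)) hb (by
      rw [sliceEval_σ_δ]
      exact hbt)
  obtain ⟨t, ht⟩ := SSet.exists_isTriangle_inverse
    (hA.isWeakInnerComplicial.hornFill_slice hC (r := 3) 1 (by decide) (by decide))
    (hA.isWeakInnerComplicial.hornFill_slice hC (r := 3) 2 (by decide) (by decide)) hz₁ hz₂
  refine ⟨sliceEval t, isStrat_sliceVal t 2 _ _ ⟨0, 1, by decide, ⟨0, rfl⟩, ⟨1, rfl⟩⟩, ?_, ?_, ?_⟩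
  · exact (sliceEval_act _ t).symm.trans (congrArg _ ht.1)
  · exact (sliceEval_act _ t).symm.trans (congrArg _ ht.2.1)
  · exact ((sliceEval_act _ t).symm.trans (congrArg _ ht.2.2)).trans (sliceEval_σ_δ 1 w)

end StratSet

/-! ### Maps out of `E⁻₁` and `E₂` -/

/-- Given a family of simplices `x` which generates `X` and a family of simplices `a` of `Y` which
satisfies the relations between the `x i`, there is a map that takes `x i` to `a i`. -/
lemma SSet.exists_hom_of_generators {X Y : SSet.{u}} {I : Type} (d : I → ℕ)
    (x : ∀ i, X _⦋d i⦌) (a : ∀ i, Y _⦋d i⦌)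
    (hx : ∀ (r : ℕ) (y : X _⦋r⦌), ∃ i φ, X.act φ (x i) = y)
    (ha : ∀ (r : ℕ) i j (φ : Fin (r + 1) →o Fin (d i + 1)) (ψ : Fin (r + 1) →o Fin (d j + 1)),
      X.act φ (x i) = X.act ψ (x j) → Y.act φ (a i) = Y.act ψ (a j)) :
    ∃ F : X ⟶ Y, ∀ i, F.app _ (x i) = a i := by
  choose i φ hφ using hx
  refine ⟨{ app n := ↾fun y => Y.act (φ n.unop.len y) (a (i n.unop.len y))
            naturality n m f := ?_ }, fun j => ?_⟩
  · ext y
    have h : Y.act (φ m.unop.len (X.act f.unop.toOrderHom y)) (a (i m.unop.len _)) =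
        Y.act f.unop.toOrderHom (Y.act (φ n.unop.len y) (a (i n.unop.len y))) := by
      rw [SSet.act_act]
      refine ha _ _ _ _ _ ?_
      rw [hφ, ← SSet.act_act, hφ]
    exact h
  · refine (ha _ _ j _ OrderHom.id ?_).trans (SSet.act_id _)
    rw [hφ, SSet.act_id]

namespace StratSet

/-- The sequence of vertices of a simplex of `E`. -/
def word {r : ℕ} (y : SSet.coherentIso.{u} _⦋r⦌) (i : Fin (r + 1)) : Bool :=
  (Codiscrete.equivFun y i).down

lemma word_injective {r : ℕ} : Function.Injective (word.{u} (r := r)) := by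
  intro y y' h
  refine Codiscrete.equivFun.injective (funext fun i => ?_)
  exact ULift.ext _ _ (congrFun h i)

lemma word_alt (p : Bool) (n : ℕ) (i : Fin (n + 1)) :
    word (alt.{u} p n) i = xor p (decide ((i : ℕ) % 2 = 1)) := rfl

lemma δ_two_alt (p : Bool) : SSet.coherentIso.δ 2 (alt.{u} p 2) = alt p 1 := by
  refine word_injective (funext fun i => ?_)
  fin_cases i <;> rfl

lemma δ_zero_alt (p : Bool) : SSet.coherentIso.δ 0 (alt.{u} p 2) = alt (!p) 1 := by
  refine word_injective (funext fun i => ?_)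
  fin_cases i <;> cases p <;> rfl

lemma δ_one_alt (p : Bool) : SSet.coherentIso.δ 1 (alt.{u} p 2) =
    SSet.coherentIso.σ 0 (SSet.coherentIso.δ 1 (alt.{u} p 1)) := by
  refine word_injective (funext fun i => ?_)
  fin_cases i <;> cases p <;> rfl

variable {A : StratSet.{u}}

lemma exists_hom_EMinusOne {v : A.toSSet _⦋1⦌} (hv : v ∈ A.thin 1) :
    ∃ f : EMinusOne.{u} ⟶ A, f.toSSetHom.app _
      (⟨alt false 1, SSet.Subcomplex.mem_ofSimplex_obj _⟩ :
        (signedSubcomplex.{u} false 1).obj (Opposite.op ⦋1⦌)) = v := by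
  have hx : ∀ (r : ℕ) (y : (signedSubcomplex.{u} false 1).toSSet _⦋r⦌),
      ∃ (_ : Unit) (φ : Fin (r + 1) →o Fin (1 + 1)),
        (signedSubcomplex.{u} false 1).toSSet.act φ
          (⟨alt false 1, SSet.Subcomplex.mem_ofSimplex_obj _⟩ :
            (signedSubcomplex.{u} false 1).obj (Opposite.op ⦋1⦌)) = y := by
    rintro r ⟨y, hy⟩
    obtain ⟨f, rfl⟩ := (SSet.Subcomplex.mem_ofSimplex_obj_iff _ _).1 hy
    exact ⟨⟨⟩, f.toOrderHom, rfl⟩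
  obtain ⟨F, hF⟩ := SSet.exists_hom_of_generators (I := Unit) (fun _ => 1) _ (fun _ => v) hx (by
    intro r _ _ φ ψ h
    refine congrArg (fun φ => A.toSSet.act φ v) ?_
    ext i : 2
    have h' := congrFun (congrArg word (congrArg Subtype.val h)) i
    have key : ∀ a b : Fin 2, word (alt.{u} false 1) a = word (alt.{u} false 1) b → a = b := by
      simp only [word_alt]
      decide
    exact key _ _ h')
  refine ⟨⟨F, fun r y hy => ?_⟩, hF ⟨⟩⟩
  have hr : 0 < r := Nat.pos_of_ne_zero (by
    rintro rfl
    exact EMinusOne.notMem_thin_zero y hy)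
  obtain ⟨-, φ, rfl⟩ := hx r y
  refine (congrArg (· ∈ A.thin r) (SSet.app_act F φ _)).mpr ?_
  rw [hF ⟨⟩]
  exact act_mem_thin_of_edge_of_pos hv hr φ

/-- A map that is not onto factors through an edge of the triangle: `e p`, `e (!p)`, or the
degenerate edge at the source of `e p`. The replacement spells the same word. -/
lemma exists_act_eq_act_edge {Y : SSet.{u}} {e : Bool → Y _⦋1⦌} {t : Bool → Y _⦋2⦌}
    (ht : ∀ p, SSet.IsTriangle (t p) (e p) (e (!p)) (Y.σ 0 (Y.δ 1 (e p)))) (p : Bool)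
    {r : ℕ} (φ : Fin (r + 1) →o Fin (2 + 1)) (hφ : ¬ Function.Surjective φ) :
    ∃ (q : Bool) (θ : Fin (r + 1) →o Fin (1 + 1)), Y.act φ (t p) = Y.act θ (e q) ∧
      ∀ i, xor p (decide ((φ i : ℕ) % 2 = 1)) = xor q (decide ((θ i : ℕ) % 2 = 1)) := by
  obtain ⟨k, hk⟩ := not_forall.1 hφ
  have hγ : ∀ x, φ x ≠ k := fun x hx => hk ⟨x, hx⟩
  choose γ hγ using fun x => Fin.exists_succAbove_eq (hγ x)
  let θ : Fin (r + 1) →o Fin (1 + 1) := ⟨γ, fun x y hxy =>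
    (Fin.succAboveOrderEmb k).le_iff_le.1 (by
      simp only [Fin.succAboveOrderEmb_apply, hγ]
      exact φ.monotone hxy)⟩
  have h1 : Y.act φ (t p) = Y.act θ (Y.δ k (t p)) := by
    rw [SSet.δ_eq_act, SSet.act_act]
    congr 1
    ext x : 2
    exact (hγ x).symm
  have hk' : ∀ k : Fin 3, k = 2 ∨ k = 0 ∨ k = 1 := by decide
  obtain rfl | rfl | rfl := hk' k
  · refine ⟨p, θ, by rw [h1, (ht p).1], fun i => ?_⟩
    have key : ∀ (p : Bool) (a : Fin 2), xor p (decide (((2 : Fin 3).succAbove a : ℕ) % 2 = 1)) =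
        xor p (decide ((a : ℕ) % 2 = 1)) := by decide
    rw [← hγ i]
    exact key _ _
  · refine ⟨!p, θ, by rw [h1, (ht p).2.1], fun i => ?_⟩
    have key : ∀ (p : Bool) (a : Fin 2), xor p (decide (((0 : Fin 3).succAbove a : ℕ) % 2 = 1)) =
        xor (!p) (decide ((a : ℕ) % 2 = 1)) := by decide
    rw [← hγ i]
    exact key _ _
  · let z : Fin (1 + 1) →o Fin (1 + 1) := ⟨fun _ => 0, fun _ _ _ => le_rfl⟩
    refine ⟨p, z.comp θ, ?_, fun i => ?_⟩
    · rw [h1, (ht p).2.2, ← SSet.act_act, SSet.σ_eq_act, SSet.δ_eq_act, SSet.act_act _ _ (e p)]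
      refine congrArg (fun g => Y.act θ (Y.act g (e p))) ?_
      ext j : 2
      revert j
      decide
    · have key : ∀ (p : Bool) (a : Fin 2), xor p (decide (((1 : Fin 3).succAbove a : ℕ) % 2 = 1)) =
          xor p (decide (((0 : Fin 2) : ℕ) % 2 = 1)) := by decide
      rw [← hγ i]
      exact key _ _

/-- For `p = q` the word determines the map. Otherwise `φ` and `ψ` differ everywhere, so by
monotonicity they are constant with opposite values, and both sides are degenerate on the vertex
that the two edges share. -/
lemma act_edge_eq {Y : SSet.{u}} {e : Bool → Y _⦋1⦌} (he : ∀ p, Y.δ 0 (e p) = Y.δ 1 (e (!p)))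
    {p q : Bool} {r : ℕ} {φ ψ : Fin (r + 1) →o Fin (1 + 1)}
    (h : ∀ i, xor p (decide ((φ i : ℕ) % 2 = 1)) = xor q (decide ((ψ i : ℕ) % 2 = 1))) :
    Y.act φ (e p) = Y.act ψ (e q) := by
  by_cases hpq : q = p
  · subst hpq
    have key : ∀ (p : Bool) (a b : Fin 2), xor p (decide ((a : ℕ) % 2 = 1)) =
        xor p (decide ((b : ℕ) % 2 = 1)) → a = b := by decide
    refine congrArg (fun φ => Y.act φ (e q)) ?_
    ext i : 2
    exact key _ _ _ (h i)
  · have hq : ∀ p q : Bool, q ≠ p → q = !p := by decide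
    obtain rfl := hq p q hpq
    have hne : ∀ (p : Bool) (a b : Fin 2), xor p (decide ((a : ℕ) % 2 = 1)) =
        xor (!p) (decide ((b : ℕ) % 2 = 1)) → a ≠ b := by decide
    let c : Fin (r + 1) →o Fin (0 + 1) := ⟨fun _ => 0, fun _ _ _ => le_rfl⟩
    have key : ∀ (p : Bool) (φ ψ : Fin (r + 1) →o Fin (1 + 1)), (∀ i, φ i ≠ ψ i) → φ 0 = 0 →
        Y.act φ (e p) = Y.act ψ (e (!p)) := by
      intro p φ ψ h h₀
      have hψ : ∀ i, ψ i = 1 := fun i => by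
        have h1 := h 0
        have h2 := ψ.monotone (Fin.zero_le i)
        rw [h₀] at h1
        generalize ψ 0 = a at h1 h2
        generalize ψ i = b at h2
        revert a b
        decide
      have hφ : ∀ i, φ i = 0 := fun i => by
        have h1 := h i
        rw [hψ] at h1
        generalize φ i = a at h1
        revert a
        decide
      calc Y.act φ (e p) = Y.act c (Y.δ 1 (e p)) := by
            rw [SSet.δ_eq_act, SSet.act_act]
            congr 1
            ext i : 2
            exact hφ i
        _ = Y.act c (Y.δ 0 (e (!p))) := by rw [he, Bool.not_not]
        _ = Y.act ψ (e (!p)) := by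
            rw [SSet.δ_eq_act, SSet.act_act]
            congr 1
            ext i : 2
            exact (hψ i).symm
    by_cases h₀ : φ 0 = 0
    · exact key p φ ψ (fun i => hne _ _ _ (h i)) h₀
    · have h₁ : ∀ a b : Fin 2, a ≠ b → a ≠ 0 → b = 0 := by decide
      have h₂ := key (!p) ψ φ (fun i => (hne _ _ _ (h i)).symm) (h₁ _ _ (hne _ _ _ (h 0)) h₀)
      rw [Bool.not_not] at h₂
      exact h₂.symm

/-- If `φ` is onto, its word changes letter twice, and only one monotone map to one of the two
generators spells such a word. If neither map is onto, both sides reduce to edges. These are all the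
relations needed to map out of `E₂`. -/
lemma act_triangle_eq {Y : SSet.{u}} {e : Bool → Y _⦋1⦌} {t : Bool → Y _⦋2⦌}
    (ht : ∀ p, SSet.IsTriangle (t p) (e p) (e (!p)) (Y.σ 0 (Y.δ 1 (e p)))) {p q : Bool}
    {r : ℕ} {φ ψ : Fin (r + 1) →o Fin (2 + 1)}
    (h : ∀ i, xor p (decide ((φ i : ℕ) % 2 = 1)) = xor q (decide ((ψ i : ℕ) % 2 = 1))) :
    Y.act φ (t p) = Y.act ψ (t q) := by
  have key : ∀ {p q : Bool} {φ ψ : Fin (r + 1) →o Fin (2 + 1)}, Function.Surjective φ →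
      (∀ i, xor p (decide ((φ i : ℕ) % 2 = 1)) = xor q (decide ((ψ i : ℕ) % 2 = 1))) →
      Y.act φ (t p) = Y.act ψ (t q) := by
    intro p q φ ψ hφ h
    have hpar : ∀ (p q : Bool) (a b : Fin 3), xor p (decide ((a : ℕ) % 2 = 1)) =
        xor q (decide ((b : ℕ) % 2 = 1)) → (p = q ↔ (a : ℕ) % 2 = (b : ℕ) % 2) := by decide
    have hpar' := fun i => hpar _ _ _ _ (h i)
    obtain ⟨i₀, hi₀⟩ := hφ 0
    obtain ⟨i₁, hi₁⟩ := hφ 1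
    obtain ⟨i₂, hi₂⟩ := hφ 2
    have hlt : ∀ {i j}, φ i < φ j → (ψ i : ℕ) ≤ ψ j := fun h =>
      ψ.monotone (φ.monotone.reflect_lt h).le
    have h₀₁ := hlt (i := i₀) (j := i₁) (by rw [hi₀, hi₁]; decide)
    have h₁₂ := hlt (i := i₁) (j := i₂) (by rw [hi₁, hi₂]; decide)
    have e₀ := hpar' i₀
    have e₁ := hpar' i₁
    have e₂ := hpar' i₂
    have v₀ : (φ i₀ : ℕ) = 0 := congrArg Fin.val hi₀
    have v₁ : (φ i₁ : ℕ) = 1 := congrArg Fin.val hi₁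
    have v₂ : (φ i₂ : ℕ) = 2 := congrArg Fin.val hi₂
    -- For `p ≠ q` the parities are opposite: `ψ` would be `1` at `i₀` and `i₂` but even at `i₁` in
    -- between.
    have hpq : p = q := by
      by_contra hpq
      simp only [hpq, false_iff] at e₀ e₁ e₂
      omega
    have hψ₁ : (ψ i₁ : ℕ) = 1 := by
      have := e₁.1 hpq
      omega
    subst hpq
    refine congrArg (fun φ => Y.act φ (t p)) ?_
    ext i
    have e := (hpar' i).1 rfl
    by_contra hne
    obtain hi | hi : (φ i : ℕ) = 0 ∨ (φ i : ℕ) = 2 := by omega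
    · have := hlt (i := i) (j := i₁) (by rw [Fin.lt_def, hi, hi₁]; decide)
      omega
    · have := hlt (i := i₁) (j := i) (by rw [Fin.lt_def, hi, hi₁]; decide)
      omega
  by_cases hφ : Function.Surjective φ
  · exact key hφ h
  by_cases hψ : Function.Surjective ψ
  · exact (key hψ fun i => (h i).symm).symm
  obtain ⟨p', θ, hθ, hθ'⟩ := exists_act_eq_act_edge ht p φ hφ
  obtain ⟨q', ω, hω, hω'⟩ := exists_act_eq_act_edge ht q ψ hψ
  rw [hθ, hω]
  refine act_edge_eq (fun p => (ht p).δ_eq.2.1) fun i => ?_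
  rw [← hθ', ← hω', h]

end StratSet

namespace StratSet

variable {A : StratSet.{u}}

lemma alt_mem_unionSubcomplex (p : Bool) :
    alt.{u} p 2 ∈ (unionSubcomplex.{u} 2).obj (Opposite.op ⦋2⦌) := by
  cases p
  · exact Or.inl (SSet.Subcomplex.mem_ofSimplex_obj _)
  · exact Or.inr (SSet.Subcomplex.mem_ofSimplex_obj _)

/-- The generating `2`-simplices of `E₂`. -/
def altETwo (p : Bool) : ETwo.{u}.toSSet _⦋2⦌ := ⟨alt p 2, alt_mem_unionSubcomplex p⟩

/-- The generating `1`-simplex of `E⁻₁`. -/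
def altEMinusOne : EMinusOne.{u}.toSSet _⦋1⦌ :=
  ⟨alt false 1, SSet.Subcomplex.mem_ofSimplex_obj _⟩

lemma exists_act_altETwo {r : ℕ} (y : ETwo.{u}.toSSet _⦋r⦌) :
    ∃ p φ, ETwo.{u}.toSSet.act φ (altETwo p) = y := by
  obtain ⟨y, hy | hy⟩ := y
  · obtain ⟨f, rfl⟩ := (SSet.Subcomplex.mem_ofSimplex_obj_iff _ _).1 hy
    exact ⟨false, f.toOrderHom, rfl⟩
  · obtain ⟨f, rfl⟩ := (SSet.Subcomplex.mem_ofSimplex_obj_iff _ _).1 hy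
    exact ⟨true, f.toOrderHom, rfl⟩

lemma mem_thin_ETwo {r : ℕ} (hr : 0 < r) (y : ETwo.{u}.toSSet _⦋r⦌) : y ∈ ETwo.{u}.thin r :=
  Or.inr ⟨hr, hr⟩

lemma δ_two_altETwo_false :
    ETwo.{u}.toSSet.δ 2 (altETwo false) = inclusionETwo.toSSetHom.app _ altEMinusOne :=
  Subtype.ext (δ_two_alt false)

lemma exists_extend_inclusionETwo {v w : A.toSSet _⦋1⦌} (h : A.AreEquivalenceInverses v w) :
    ∃ g : ETwo.{u} ⟶ A, g.toSSetHom.app _ (ETwo.{u}.toSSet.δ 2 (altETwo false)) = v := by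
  obtain ⟨hv, hw, ⟨a, ha, hat⟩, ⟨a', ha', hat'⟩⟩ := h
  let e : Bool → A.toSSet _⦋1⦌ := Bool.rec v w
  let t : Bool → A.toSSet _⦋2⦌ := Bool.rec a a'
  have ht : ∀ p, SSet.IsTriangle (t p) (e p) (e (!p)) (A.toSSet.σ 0 (A.toSSet.δ 1 (e p))) := by
    rintro (_ | _)
    · exact hat
    · exact hat'
  have he : ∀ p, e p ∈ A.thin 1 := by
    rintro (_ | _)
    · exact hv
    · exact hw
  have htt : ∀ p, t p ∈ A.thin 2 := by
    rintro (_ | _)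
    · exact ha
    · exact ha'
  obtain ⟨F, hF⟩ := SSet.exists_hom_of_generators (X := ETwo.{u}.toSSet) (fun _ : Bool => 2)
    altETwo t (fun r y => exists_act_altETwo y) fun r p q φ ψ h =>
      act_triangle_eq ht fun i => congrFun (congrArg word (congrArg Subtype.val h)) i
  refine ⟨⟨F, fun r y hy => ?_⟩, ?_⟩
  · have hr : 0 < r := Nat.pos_of_ne_zero (by
      rintro rfl
      exact ETwo.notMem_thin_zero y hy)
    obtain ⟨p, φ, rfl⟩ := exists_act_altETwo y
    rw [SSet.app_act, hF]
    refine act_mem_thin_of_triangle_of_pos (htt p) (fun i => ?_) hr φ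
    fin_cases i
    · exact (ht p).2.1 ▸ he _
    · exact (ht p).2.2 ▸ A.degenerate_subset_thin _ (A.toSSet.σ_mem_degenerate _ _)
    · exact (ht p).1 ▸ he _
  · refine (SSet.app_δ F 2 _).trans ?_
    rw [hF]
    exact (ht false).1

lemma HasInverses.hasRLP_inclusionETwo (h : A.HasInverses) : HasRLP inclusionETwo.{u} A := by
  intro f
  obtain ⟨w, hw⟩ := h _ (f.map_thin 1 altEMinusOne (Or.inr ⟨one_pos, Nat.one_pos⟩))
  obtain ⟨g, hg⟩ := exists_extend_inclusionETwo hw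
  refine ⟨g, Hom.ext ?_⟩
  ext ⟨⟨r⟩⟩ ⟨y, hy⟩
  obtain ⟨φ, rfl⟩ := (SSet.Subcomplex.mem_ofSimplex_obj_iff _ _).1 hy
  rw [δ_two_altETwo_false] at hg
  have h₁ := SSet.app_act (inclusionETwo ≫ g).toSSetHom φ.toOrderHom altEMinusOne
  have h₂ := SSet.app_act f.toSSetHom φ.toOrderHom altEMinusOne
  exact h₁.trans ((congrArg _ hg).trans h₂.symm)

lemma hasInverses_of_hasRLP_inclusionETwo (h : HasRLP inclusionETwo.{u} A) : A.HasInverses := by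
  intro v hv
  obtain ⟨f, hf⟩ := exists_hom_EMinusOne hv
  obtain ⟨g, rfl⟩ := h f
  let X : SSet.{u} := ETwo.{u}.toSSet
  let g' : X ⟶ A.toSSet := g.toSSetHom
  have h₂ : X.δ 2 (altETwo true) = X.δ 0 (altETwo false) :=
    Subtype.ext ((δ_two_alt true).trans (δ_zero_alt false).symm)
  have h₀ : X.δ 0 (altETwo true) = X.δ 2 (altETwo false) :=
    Subtype.ext ((δ_zero_alt true).trans (δ_two_alt false).symm)
  have h₁ : ∀ p, X.δ 1 (altETwo p) = X.σ 0 (X.δ 1 (X.δ 2 (altETwo p))) := fun p =>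
    Subtype.ext ((δ_one_alt p).trans (congrArg (fun x => SSet.coherentIso.σ 0
      (SSet.coherentIso.δ 1 x)) (δ_two_alt p).symm))
  have hv' : g'.app _ (X.δ 2 (altETwo false)) = v :=
    (congrArg (g'.app _) δ_two_altETwo_false).trans hf
  refine ⟨g'.app _ (X.δ 0 (altETwo false)), hv, g.map_thin 1 _ (mem_thin_ETwo one_pos _),
    ⟨g'.app _ (altETwo false), g.map_thin 2 _ (mem_thin_ETwo two_pos _), ?_, ?_, ?_⟩,
    ⟨g'.app _ (altETwo true), g.map_thin 2 _ (mem_thin_ETwo two_pos _), ?_, ?_, ?_⟩⟩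
  · rw [← SSet.app_δ, hv']
  · rw [← SSet.app_δ]
  · rw [← SSet.app_δ, h₁, SSet.app_σ, SSet.app_δ, hv']
  · rw [← SSet.app_δ, h₂]
  · rw [← SSet.app_δ, h₀, hv']
  · rw [← SSet.app_δ, h₁, SSet.app_σ, SSet.app_δ, h₂]

end StratSet

theorem mainTheorem12 (A : StratSet.{u}) (hA : A.IsWeakInnerComplicial) :
    (A.IsWeakComplicial ↔ StratSet.HasRLP StratSet.inclusionETwo.{u} A) ∧
      (StratSet.HasRLP StratSet.inclusionETwo.{u} A ↔
        ∀ v : A.toSSet _⦋1⦌, v ∈ A.thin 1 →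
          ∃ w : A.toSSet _⦋1⦌,
            A.AreEquivalenceInverses v w) := by
  have h : StratSet.HasRLP StratSet.inclusionETwo.{u} A ↔ A.HasInverses :=
    ⟨StratSet.hasInverses_of_hasRLP_inclusionETwo, fun h => h.hasRLP_inclusionETwo⟩
  exact ⟨⟨fun h' => h.2 h'.hasInverses, fun h' => hA.isWeakComplicial (h.1 h')⟩, h⟩
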